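/- Let $\omega(x)=e^{-x^2}$, let $H_n(x)=\frac{(-1)^n}{\omega(x)}\frac{d^n\omega}{dx^n}(x)$ be the Hermite polynomials, let $\gamma_n=2^n n!\sqrt{\pi}$, and for $f\in L^2_\omega(\mathbb{R})$ put $a_n=\frac1{\gamma_n}\int_{\mathbb{R}} f(x)H_n(x)\omega(x)\,dx$, $\Pi_n^{\mathrm P}f=\sum_{k=0}^n a_kH_k$ and $\|f\|_{L^2_\omega(\mathbb{R})}=\bigl(\int_{\mathbb{R}}|f(x)|^2\omega(x)\,dx\bigr)^{1/2}$. Let $\rho>0$, let $\mathcal S_\rho=\{z\in\mathbb{C}:-\rho\le\Im z\le\rho\}$, and let $f$ be analytic (with complex values) in the closed strip $\mathcal S_\rho$, i.e. in a neighbourhood of each of its points. Suppose that for some $\sigma\in\mathbb{R}$ one has $f(z)=O(|z|^\sigma)$ as $|z|\to\infty$ within $\mathcal S_\rho$. Put $$V=\int_{\partial\mathcal S_\rho}\bigl|e^{-z^2/2}f(z)\bigr|\,|dz|,$$ the integral with respect to arc length over the two lines $\Im z=\pm\rho$. Then $V<\infty$, $f|_{\mathbb{R}}\in L^2_\omega(\mathbb{R})$,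 and: (i) There are real numbers $K_n$ with $K_n\to V$ as $n\to\infty$ such that for every integer $n\ge\max\{\lfloor\sigma\rfloor,0\}$ $$|a_n|\le\frac{K_n\,e^{-\rho\sqrt{2(n+1)}}}{2^n\sqrt{2\pi(n+1)}\;\Gamma\!\left(\frac{n+1}{2}\right)}.$$ (ii) There are real numbers $K_n'$ with $K_n'\to V/\sqrt{4\pi\rho}$ as $n\to\infty$ such that for every integer $n\ge 0$ $$\|f-\Pi_n^{\mathrm P}f\|_{L^2_\omega(\mathbb{R})}\le K_n'\,e^{-\rho\sqrt{2n}}.$$ -/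

import Mathlib

open Filter Topology Asymptotics MeasureTheory

noncomputable section

/-- The Hermite weight `ω(x) = exp (-x²)`. -/
def hermiteWeight (x : ℝ) : ℝ := Real.exp (-x ^ 2)

/-- The (physicists') Hermite polynomial `H_n`, by Rodrigues' formula. -/
def hermiteH (n : ℕ) (x : ℝ) : ℝ :=
  (-1) ^ n / hermiteWeight x * iteratedDeriv n hermiteWeight x

/-- The normalization constant `γ_n = 2ⁿ n! √π`, the squared weighted norm of `H_n`. -/
def hermiteGamma (n : ℕ) : ℝ := 2 ^ n * (n.factorial : ℝ) * Real.sqrt Real.pi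

/-- The Hermite coefficient `a_n = ⟨g, H_n⟩_ω / γ_n` of a function on the real line. -/
def hermiteCoeff (g : ℝ → ℂ) (n : ℕ) : ℂ :=
  (∫ x : ℝ, g x * (hermiteH n x : ℂ) * (hermiteWeight x : ℂ)) / (hermiteGamma n : ℂ)

/-- The Hermite projection `Π_n g = ∑_{k ≤ n} a_k H_k`. -/
def hermiteProj (n : ℕ) (g : ℝ → ℂ) (x : ℝ) : ℂ :=
  ∑ k ∈ Finset.range (n + 1), hermiteCoeff g k * (hermiteH k x : ℂ)

/-- Membership in `L²_ω(ℝ)`: measurable, with `|g|² ω` integrable. -/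
def MemL2Weight (g : ℝ → ℂ) : Prop :=
  AEStronglyMeasurable g volume ∧ Integrable (fun x : ℝ => ‖g x‖ ^ 2 * hermiteWeight x)

/-- The norm of `L²_ω(ℝ)`. -/
def normL2Weight (g : ℝ → ℂ) : ℝ :=
  Real.sqrt (∫ x : ℝ, ‖g x‖ ^ 2 * hermiteWeight x)

/-- The closed strip `{z : -ρ ≤ Im z ≤ ρ}`. -/
def closedStrip (ρ : ℝ) : Set ℂ := {z : ℂ | z.im ∈ Set.Icc (-ρ) ρ}

/-- Integrability with respect to arc length on the two lines `Im z = ±ρ`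
bounding the strip. -/
def StripBoundaryIntegrable (ρ : ℝ) (g : ℂ → ℝ) : Prop :=
  Integrable (fun x : ℝ => g ((x : ℂ) + (ρ : ℂ) * Complex.I)) ∧
    Integrable (fun x : ℝ => g ((x : ℂ) - (ρ : ℂ) * Complex.I))

/-- The integral with respect to arc length over the boundary of the strip. -/
def stripBoundaryIntegral (ρ : ℝ) (g : ℂ → ℝ) : ℝ :=
  (∫ x : ℝ, g ((x : ℂ) + (ρ : ℂ) * Complex.I)) +
    (∫ x : ℝ, g ((x : ℂ) - (ρ : ℂ) * Complex.I))

/-- The integrand `|exp (-z²/2) f(z)|`. -/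
def gaussAbs (f : ℂ → ℂ) (z : ℂ) : ℝ := ‖Complex.exp (-z ^ 2 / 2) * f z‖

/-- `V = ∫_{∂S_ρ} |exp (-z²/2) f(z)| |dz|`. -/
def stripV (ρ : ℝ) (f : ℂ → ℂ) : ℝ := stripBoundaryIntegral ρ (gaussAbs f)

end

/-!
The coefficient is `γ_n a_n = (-1)ⁿ ∫ f ω⁽ⁿ⁾`, and the Gaussian weight is its own Fourier transform
up to scaling, so that `ω⁽ⁿ⁾` is an integral of `(i t)ⁿ exp (-t²/4) exp (i t x)` over `t ∈ ℝ`.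
Splitting it at `t = 0` gives `2 √π ω⁽ⁿ⁾(x) = iⁿ G_n(x) + (-i)ⁿ G_n(-x)` with the entire function
`G_n(z) = ∫_0^∞ tⁿ exp (-t²/4 + i t z) dt` (`iteratedDeriv_hermiteWeight_eq_gaussHalf`). The first
half is small in the upper and the second in the lower half plane, so the two contours are moved to
the lines `Im z = ρ` and `Im z = -ρ` (`integral_eq_integral_add_mul_I`).

The factor `tⁿ exp (-t²/4)` peaks at the saddle point `T = √(2n)`. Centring there yields
`G_n(z) = Tⁿ exp (-T²/4) exp (i T z) F_n(z)`, where
`F_n(z) = ∫_{s > -T} (1 + s/T)ⁿ exp (-T s/2 - s²/4 + i s z) ds`. The exponential `exp (i T z)` has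
modulus `exp (-ρ √(2n))` on the shifted line. Since `(1 + s/T)ⁿ exp (-T s/2) ≤ 1` tends to
`exp (-s²/4)`, dominated convergence gives `F_n(z) → √(2π) exp (-z²/2)` (`tendsto_saddleIntegral`);
this is where the Gaussian in `V` comes from. Repeated integration by parts bounds `F_n(z)` by any
negative power of `|z|` on the strip, uniformly in `n` (`exists_pow_mul_norm_saddleIntegral_le`).
Against the polynomial growth of `f` this justifies both the contour shift and a second passage to
the limit, `∫ |F_n f| |dz| → √(2π) V` over the boundary (`tendsto_saddleBoundaryIntegral`). The
constant `Tⁿ exp (-T²/4)` is eliminated through `G_n(0) = 2ⁿ Γ((n+1)/2)`, and the coefficient bound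
follows from the duplication formula and `Γ(x + 1/2) ~ √x Γ(x)`.

For the projection error, the Hermite functions form a Hilbert basis of `L²(ℝ)`: a function
orthogonal to all of them has, after multiplication by `exp (-x²/2)`, vanishing moments and hence
vanishing Fourier transform. Parseval's identity makes the squared error equal to
`∑_{k > n} γ_k |a_k|²`, whose terms are asymptotically at most
`V²/(2π) · exp (-2 ρ √(2k)) / √(2k)`; comparison with the integral, in the telescoping form
`exp_neg_saddle_div_le`, sums the tail to `V²/(4πρ) · exp (-2 ρ √(2n))`.
-/

/-! ### Hermite polynomials and their orthogonality -/

/-- The Hermite polynomial as a formal polynomial, defined by `H₀ = 1`,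
`H_{n+1} = 2 X H_n - H_n'`. -/
noncomputable def hermitePoly : ℕ → Polynomial ℝ
  | 0 => 1
  | n + 1 => 2 * Polynomial.X * hermitePoly n - Polynomial.derivative (hermitePoly n)

theorem hermiteWeight_pos (x : ℝ) : 0 < hermiteWeight x := Real.exp_pos _

theorem hasDerivAt_hermiteWeight (x : ℝ) :
    HasDerivAt hermiteWeight (-(2 * x) * hermiteWeight x) x := by
  have h : HasDerivAt (fun y : ℝ => -y ^ 2) (-(2 * x)) x := by
    simpa using (hasDerivAt_pow 2 x).fun_neg
  have h2 := h.exp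
  rw [mul_comm] at h2
  exact h2

theorem hasDerivAt_eval_mul_hermiteWeight (p : Polynomial ℝ) (x : ℝ) :
    HasDerivAt (fun y => p.eval y * hermiteWeight y)
      ((p.derivative - 2 * Polynomial.X * p).eval x * hermiteWeight x) x := by
  refine ((p.hasDerivAt x).fun_mul (hasDerivAt_hermiteWeight x)).congr_deriv ?_
  simp only [Polynomial.eval_sub, Polynomial.eval_mul, Polynomial.eval_X, Polynomial.eval_ofNat]
  ring

theorem iteratedDeriv_hermiteWeight (n : ℕ) :
    iteratedDeriv n hermiteWeight =
      fun x => (-1) ^ n * ((hermitePoly n).eval x * hermiteWeight x) := by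
  induction n with
  | zero => ext x; simp [hermitePoly]
  | succ n ih =>
    ext x
    rw [iteratedDeriv_succ, ih,
      ((hasDerivAt_eval_mul_hermiteWeight (hermitePoly n) x).const_mul _).deriv]
    simp [hermitePoly, pow_succ]; ring

theorem hermiteH_eq_eval (n : ℕ) (x : ℝ) : hermiteH n x = (hermitePoly n).eval x := by
  have h := (hermiteWeight_pos x).ne'
  rw [hermiteH, iteratedDeriv_hermiteWeight]
  have : ((-1 : ℝ) ^ n) * (-1) ^ n = 1 := by rw [← mul_pow]; simp
  field_simp
  linear_combination (Polynomial.eval x (hermitePoly n)) * this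

theorem natDegree_hermitePoly_le_and_coeff (n : ℕ) :
    (hermitePoly n).natDegree ≤ n ∧ (hermitePoly n).coeff n = 2 ^ n := by
  induction n with
  | zero => simp [hermitePoly]
  | succ n ih =>
    have h2 : (2 : Polynomial ℝ) = Polynomial.C 2 := rfl
    have hd : (hermitePoly n).derivative.natDegree ≤ n :=
      (Polynomial.natDegree_derivative_le _).trans (by omega)
    constructor
    · rw [hermitePoly, h2, mul_assoc]
      refine (Polynomial.natDegree_sub_le _ _).trans (max_le ?_ (by omega))
      refine (Polynomial.natDegree_C_mul_le _ _).trans ?_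
      refine Polynomial.natDegree_mul_le.trans ?_
      have := Polynomial.natDegree_X_le (R := ℝ)
      omega
    · rw [hermitePoly, h2, mul_assoc, Polynomial.coeff_sub, Polynomial.coeff_C_mul,
        Polynomial.coeff_X_mul, ih.2, Polynomial.coeff_eq_zero_of_natDegree_lt (by omega)]
      ring

theorem integrable_pow_mul_exp_neg_mul_sq {b : ℝ} (hb : 0 < b) (k : ℕ) :
    Integrable fun x : ℝ => x ^ k * Real.exp (-b * x ^ 2) := by
  have := integrable_rpow_mul_exp_neg_mul_sq hb (s := k) (by linarith [k.cast_nonneg (α := ℝ)])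
  simpa using this

theorem integrable_eval_mul_exp_neg_mul_sq {b : ℝ} (hb : 0 < b) (p : Polynomial ℝ) :
    Integrable fun x : ℝ => p.eval x * Real.exp (-b * x ^ 2) := by
  induction p using Polynomial.induction_on' with
  | add p q hp hq => simpa only [Polynomial.eval_add, add_mul] using hp.fun_add hq
  | monomial n a =>
    simpa [mul_assoc] using (integrable_pow_mul_exp_neg_mul_sq hb n).const_mul a

theorem integrable_eval_mul_hermiteWeight (p : Polynomial ℝ) :
    Integrable fun x : ℝ => p.eval x * hermiteWeight x := by
  simpa [hermiteWeight] using integrable_eval_mul_exp_neg_mul_sq one_pos p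

/-- `∫ p H_{n+1} ω = ∫ p' H_n ω`, because `(H_n ω)' = -H_{n+1} ω`. -/
theorem integral_eval_mul_hermitePoly_succ (p : Polynomial ℝ) (n : ℕ) :
    ∫ x, (p * hermitePoly (n + 1)).eval x * hermiteWeight x =
      ∫ x, (p.derivative * hermitePoly n).eval x * hermiteWeight x := by
  have h := integral_eq_zero_of_hasDerivAt_of_integrable
    (f := fun y => (p * hermitePoly n).eval y * hermiteWeight y)
    (fun x => hasDerivAt_eval_mul_hermiteWeight (p * hermitePoly n) x)
    (integrable_eval_mul_hermiteWeight _) (integrable_eval_mul_hermiteWeight _)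
  rw [← sub_eq_zero, ← integral_sub (integrable_eval_mul_hermiteWeight _)
    (integrable_eval_mul_hermiteWeight _), ← neg_eq_zero, ← integral_neg, ← h]
  congr 1
  ext x
  simp [hermitePoly]
  ring

theorem integral_eval_mul_hermitePoly (p : Polynomial ℝ) (n : ℕ) :
    ∫ x, (p * hermitePoly n).eval x * hermiteWeight x =
      ∫ x, (Polynomial.derivative^[n] p).eval x * hermiteWeight x := by
  induction n generalizing p with
  | zero => simp [hermitePoly]
  | succ n ih => rw [integral_eval_mul_hermitePoly_succ, ih, Function.iterate_succ_apply]

theorem integral_hermiteWeight : ∫ x, hermiteWeight x = Real.sqrt Real.pi := by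
  simpa [hermiteWeight] using integral_gaussian 1

theorem hermiteGamma_pos (n : ℕ) : 0 < hermiteGamma n := by
  unfold hermiteGamma; positivity

theorem integral_hermitePoly_sq (n : ℕ) :
    ∫ x, (hermitePoly n * hermitePoly n).eval x * hermiteWeight x = hermiteGamma n := by
  obtain ⟨h1, h2⟩ := natDegree_hermitePoly_le_and_coeff n
  have hd : Polynomial.derivative^[n] (hermitePoly n) =
      Polynomial.C ((n.factorial : ℝ) * 2 ^ n) := by
    have hdeg : (Polynomial.derivative^[n] (hermitePoly n)).natDegree ≤ 0 := by
      have := Polynomial.natDegree_iterate_derivative (hermitePoly n) n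
      omega
    rw [Polynomial.eq_C_of_natDegree_le_zero hdeg, Polynomial.coeff_iterate_derivative]
    simp [h2, Nat.descFactorial_self]
  rw [integral_eval_mul_hermitePoly, hd]
  simp only [Polynomial.eval_C]
  rw [integral_const_mul, integral_hermiteWeight, hermiteGamma]
  ring

theorem integral_hermitePoly_mul_of_lt {m n : ℕ} (h : m < n) :
    ∫ x, (hermitePoly m * hermitePoly n).eval x * hermiteWeight x = 0 := by
  rw [integral_eval_mul_hermitePoly, Polynomial.iterate_derivative_eq_zero
    ((natDegree_hermitePoly_le_and_coeff m).1.trans_lt h)]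
  simp

theorem integral_hermitePoly_mul_of_ne {m n : ℕ} (h : m ≠ n) :
    ∫ x, (hermitePoly m * hermitePoly n).eval x * hermiteWeight x = 0 := by
  rcases h.lt_or_gt with h | h
  · exact integral_hermitePoly_mul_of_lt h
  · rw [mul_comm]; exact integral_hermitePoly_mul_of_lt h

/-! ### Completeness of the Hermite functions and Parseval's identity -/

/-- Completing the square: `c |x| ≤ (b/2) x² + c²/(2b)`. -/
theorem exp_abs_mul_exp_neg_sq_le {b : ℝ} (hb : 0 < b) (c x : ℝ) :
    Real.exp (c * |x|) * Real.exp (-b * x ^ 2) ≤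
      Real.exp (c ^ 2 / (2 * b)) * Real.exp (-(b / 2) * x ^ 2) := by
  rw [← Real.exp_add, ← Real.exp_add, Real.exp_le_exp]
  have h : 0 ≤ (b * |x| - c) ^ 2 / (2 * b) := by positivity
  have h2 : (b * |x| - c) ^ 2 / (2 * b) = b / 2 * |x| ^ 2 - c * |x| + c ^ 2 / (2 * b) := by
    field_simp; ring
  rw [sq_abs] at h2
  linarith

theorem integrable_abs_pow_mul_exp_abs_mul_exp_neg_sq {b : ℝ} (hb : 0 < b) (c : ℝ) (k : ℕ) :
    Integrable fun x : ℝ => |x| ^ k * (Real.exp (c * |x|) * Real.exp (-b * x ^ 2)) := by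
  have h := ((integrable_pow_mul_exp_neg_mul_sq (half_pos hb) k).norm).const_mul
    (Real.exp (c ^ 2 / (2 * b)))
  refine h.mono' (by fun_prop) (ae_of_all _ fun x => ?_)
  rw [Real.norm_of_nonneg (by positivity), norm_mul, norm_pow, Real.norm_eq_abs,
    Real.norm_of_nonneg (Real.exp_pos _).le]
  calc _ ≤ |x| ^ k * (Real.exp (c ^ 2 / (2 * b)) * Real.exp (-(b / 2) * x ^ 2)) := by
        gcongr _ * ?_; exact exp_abs_mul_exp_neg_sq_le hb c x
    _ = _ := by ring

open FourierTransform in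
/-- Injectivity of the Fourier transform on `L¹(ℝ)`: test against Schwartz functions. -/
theorem ae_eq_zero_of_fourier_eq_zero {w : ℝ → ℂ} (hw : Integrable w) (h : ∀ t, 𝓕 w t = 0) :
    w =ᵐ[volume] 0 := by
  apply ae_eq_zero_of_integral_contDiff_smul_eq_zero hw.locallyIntegrable
  intro g g_smooth g_cpt
  have hg₁ : HasCompactSupport (Complex.ofRealCLM ∘ g) := g_cpt.comp_left rfl
  have hg₂ : ContDiff ℝ (⊤ : ℕ∞) (Complex.ofRealCLM ∘ g) := by fun_prop
  set φ : SchwartzMap ℝ ℂ := hg₁.toSchwartzMap hg₂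
  set ψ : SchwartzMap ℝ ℂ := 𝓕⁻ φ
  have hφ : (𝓕 ψ : SchwartzMap ℝ ℂ) = φ := by simp [ψ]
  have key := VectorFourier.integral_fourierIntegral_smul_eq_flip (L := innerₗ ℝ) (μ := volume)
    (ν := volume) (e := Real.fourierChar) (f := ⇑ψ) (g := w) Real.continuous_fourierChar
    (by exact continuous_inner) ψ.integrable hw
  have h1 : ∀ x, VectorFourier.fourierIntegral Real.fourierChar volume (innerₗ ℝ) (⇑ψ) x
      = (g x : ℂ) := by
    intro x
    change (𝓕 (⇑ψ) : ℝ → ℂ) x = _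
    rw [← SchwartzMap.fourier_coe, hφ]
    rfl
  have h2 : ∀ x, VectorFourier.fourierIntegral Real.fourierChar volume (innerₗ ℝ).flip w x
      = 0 := by
    intro x
    rw [flip_innerₗ]
    exact h x
  simp only [h1, h2, smul_zero, integral_zero] at key
  rw [← key]
  congr 1

/-- A function with vanishing moments and enough exponential integrability vanishes: its Fourier
transform is the integral of a power series whose every term has integral zero. -/
theorem ae_eq_zero_of_moments_eq_zero {w : ℝ → ℂ}
    (hw : AEStronglyMeasurable w)
    (hexp : ∀ c : ℝ, Integrable fun x => Real.exp (c * |x|) * ‖w x‖)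
    (hmom : ∀ k : ℕ, ∫ x : ℝ, (x : ℂ) ^ k * w x = 0) :
    w =ᵐ[volume] 0 := by
  have hint : Integrable w := by
    rw [← integrable_norm_iff hw]; simpa using hexp 0
  refine ae_eq_zero_of_fourier_eq_zero hint fun t => ?_
  rw [Real.fourier_real_eq_integral_exp_smul]
  set c : ℂ := -2 * Real.pi * t * Complex.I with hc
  have hpart : ∀ N : ℕ, ∫ x : ℝ, (∑ k ∈ Finset.range N, (c * x) ^ k / k.factorial) * w x = 0 := by
    intro N
    have hI : ∀ k : ℕ, Integrable fun x : ℝ => (x : ℂ) ^ k * w x := by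
      intro k
      refine ((hexp 1).const_mul (k.factorial : ℝ)).mono'
        (by fun_prop) (ae_of_all _ fun x => ?_)
      rw [norm_mul, norm_pow, Complex.norm_real, Real.norm_eq_abs, ← mul_assoc, one_mul]
      gcongr
      have := Real.pow_div_factorial_le_exp |x| (abs_nonneg x) k
      rwa [div_le_iff₀' (by positivity)] at this
    simp_rw [Finset.sum_mul]
    have e : ∀ (k : ℕ) (x : ℝ), (c * x) ^ k / k.factorial * w x =
        (c ^ k / k.factorial) * ((x : ℂ) ^ k * w x) := by intro k x; ring
    simp_rw [e]
    rw [integral_finsetSum _ fun k _ => (hI k).const_mul _]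
    exact Finset.sum_eq_zero fun k _ => by rw [integral_const_mul, hmom, mul_zero]
  have hlim : Tendsto (fun N : ℕ => ∫ x : ℝ,
      (∑ k ∈ Finset.range N, (c * x) ^ k / k.factorial) * w x) atTop
      (𝓝 (∫ x : ℝ, Complex.exp (c * x) * w x)) := by
    refine tendsto_integral_of_dominated_convergence
      (fun x => Real.exp (‖c‖ * |x|) * ‖w x‖) (fun N => by fun_prop) (hexp _)
      (fun N => ae_of_all _ fun x => ?_) (ae_of_all _ fun x => ?_)
    · rw [norm_mul]
      gcongr
      refine (norm_sum_le _ _).trans ?_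
      have := Real.sum_le_exp_of_nonneg (x := ‖c‖ * |x|) (by positivity) N
      refine le_trans (le_of_eq ?_) this
      refine Finset.sum_congr rfl fun k _ => ?_
      simp
    · refine Tendsto.mul_const _ ?_
      have := NormedSpace.expSeries_div_hasSum_exp (c * (x : ℂ))
      rw [← Complex.exp_eq_exp_ℂ] at this
      exact this.tendsto_sum_nat
  simp_rw [hpart] at hlim
  have h0 := tendsto_nhds_unique hlim tendsto_const_nhds
  rw [← h0]
  congr 1
  ext x
  rw [smul_eq_mul, hc]
  congr 2
  push_cast
  ring

/-- The `n`-th normalized Hermite function `H_n(x) exp (-x²/2) / √γ_n`. -/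
noncomputable def hermiteFun (n : ℕ) (x : ℝ) : ℂ :=
  (((hermitePoly n).eval x * Real.exp (-(1 / 2) * x ^ 2) / Real.sqrt (hermiteGamma n) : ℝ) : ℂ)

theorem exp_neg_half_sq_mul_self (x : ℝ) :
    Real.exp (-(1 / 2) * x ^ 2) * Real.exp (-(1 / 2) * x ^ 2) = hermiteWeight x := by
  rw [← Real.exp_add, hermiteWeight]; congr 1; ring

theorem continuous_hermiteFun (n : ℕ) : Continuous (hermiteFun n) := by
  unfold hermiteFun; fun_prop

theorem hermiteFun_mul (m n : ℕ) (x : ℝ) :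
    hermiteFun m x * hermiteFun n x = (((hermitePoly m * hermitePoly n).eval x * hermiteWeight x /
      (Real.sqrt (hermiteGamma m) * Real.sqrt (hermiteGamma n)) : ℝ) : ℂ) := by
  rw [hermiteFun, hermiteFun, ← Complex.ofReal_mul, ← exp_neg_half_sq_mul_self, Polynomial.eval_mul]
  congr 1
  ring

theorem conj_hermiteFun (n : ℕ) (x : ℝ) :
    (starRingEnd ℂ) (hermiteFun n x) = hermiteFun n x := Complex.conj_ofReal _

theorem memLp_hermiteFun (n : ℕ) : MemLp (hermiteFun n) 2 := by
  rw [memLp_two_iff_integrable_sq_norm (continuous_hermiteFun n).aestronglyMeasurable]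
  have h := (integrable_eval_mul_hermiteWeight (hermitePoly n * hermitePoly n)).div_const
    (Real.sqrt (hermiteGamma n) * Real.sqrt (hermiteGamma n))
  refine h.congr (ae_of_all _ fun x => ?_)
  simp only []
  symm
  rw [sq, ← norm_mul, hermiteFun_mul, Complex.norm_real, Real.norm_of_nonneg]
  rw [Polynomial.eval_mul]
  have := hermiteWeight_pos x
  have := mul_self_nonneg ((hermitePoly n).eval x)
  positivity

theorem orthonormal_hermiteFun :
    Orthonormal ℂ fun n => (memLp_hermiteFun n).toLp (hermiteFun n) := by
  rw [orthonormal_iff_ite]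
  intro m n
  rw [L2.inner_def]
  have : ∫ x, inner ℂ ((memLp_hermiteFun m).toLp _ x) ((memLp_hermiteFun n).toLp _ x) =
      ∫ x, hermiteFun m x * hermiteFun n x := by
    refine integral_congr_ae ?_
    filter_upwards [(memLp_hermiteFun m).coeFn_toLp, (memLp_hermiteFun n).coeFn_toLp] with x h1 h2
    rw [h1, h2, RCLike.inner_apply, conj_hermiteFun, mul_comm]
  rw [this]
  simp_rw [hermiteFun_mul]
  rw [integral_complex_ofReal, integral_div]
  split_ifs with h
  · subst h
    rw [integral_hermitePoly_sq, Real.mul_self_sqrt (hermiteGamma_pos m).le,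
      div_self (hermiteGamma_pos m).ne', Complex.ofReal_one]
  · rw [integral_hermitePoly_mul_of_ne h, zero_div, Complex.ofReal_zero]

theorem integral_mul_hermiteFun_eq_inner {u : ℝ → ℂ} (hu : MemLp u 2) (n : ℕ) :
    inner ℂ ((memLp_hermiteFun n).toLp (hermiteFun n)) (hu.toLp u) =
      ∫ x, u x * hermiteFun n x := by
  rw [L2.inner_def]
  refine integral_congr_ae ?_
  filter_upwards [(memLp_hermiteFun n).coeFn_toLp, hu.coeFn_toLp] with x h1 h2
  rw [h1, h2, RCLike.inner_apply, conj_hermiteFun]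

theorem degree_hermitePoly (n : ℕ) : (hermitePoly n).degree = n := by
  obtain ⟨h1, h2⟩ := natDegree_hermitePoly_le_and_coeff n
  refine le_antisymm (Polynomial.natDegree_le_iff_degree_le.1 h1) ?_
  exact Polynomial.le_degree_of_ne_zero (by rw [h2]; positivity)

theorem span_hermitePoly : Submodule.span ℝ (Set.range hermitePoly) = ⊤ := by
  let S : Polynomial.Sequence ℝ := ⟨hermitePoly, degree_hermitePoly⟩
  exact S.span fun i => by simp

theorem memLp_exp_abs_mul_exp_neg_half_sq (c : ℝ) :
    MemLp (fun x : ℝ => Real.exp (c * |x|) * Real.exp (-(1 / 2) * x ^ 2)) 2 := by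
  rw [memLp_two_iff_integrable_sq (by fun_prop)]
  have h := integrable_abs_pow_mul_exp_abs_mul_exp_neg_sq one_pos (2 * c) 0
  refine h.congr (ae_of_all _ fun x => ?_)
  simp only [pow_zero, one_mul]
  rw [← Real.exp_add, ← Real.exp_add, ← Real.exp_nat_mul]
  congr 1
  push_cast
  ring

/-- The Hermite functions are complete in `L²(ℝ)`. -/
theorem eq_zero_of_integral_mul_hermiteFun_eq_zero {u : ℝ → ℂ} (hu : MemLp u 2)
    (h : ∀ n, ∫ x, u x * hermiteFun n x = 0) : u =ᵐ[volume] 0 := by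
  set w : ℝ → ℂ := fun x => (Real.exp (-(1 / 2) * x ^ 2) : ℂ) * u x with hw
  have hwm : AEStronglyMeasurable w := by
    have := hu.aestronglyMeasurable
    exact (Continuous.aestronglyMeasurable (by fun_prop)).mul this
  have hexp : ∀ c : ℝ, Integrable fun x => Real.exp (c * |x|) * ‖w x‖ := by
    intro c
    refine ((memLp_exp_abs_mul_exp_neg_half_sq c).integrable_mul hu.norm).congr
      (ae_of_all _ fun x => ?_)
    simp only [hw, Pi.mul_apply, norm_mul, Complex.norm_real, Real.norm_eq_abs, Real.abs_exp]
    ring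
  have hint : ∀ p : Polynomial ℝ, Integrable fun x : ℝ => ((p.eval x : ℝ) : ℂ) * w x := by
    intro p
    induction p using Polynomial.induction_on' with
    | add p q hp hq =>
        simp only [Polynomial.eval_add, add_mul, Complex.ofReal_add]
        exact hp.fun_add hq
    | monomial k a =>
      refine ((hexp 1).const_mul (|a| * k.factorial)).mono'
        (by fun_prop) (ae_of_all _ fun x => ?_)
      rw [norm_mul, Complex.norm_real, Polynomial.eval_monomial, norm_mul, norm_pow,
        Real.norm_eq_abs, Real.norm_eq_abs, ← mul_assoc, one_mul]
      refine mul_le_mul_of_nonneg_right ?_ (norm_nonneg _)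
      rw [mul_assoc]
      refine mul_le_mul_of_nonneg_left ?_ (abs_nonneg a)
      have := Real.pow_div_factorial_le_exp |x| (abs_nonneg x) k
      rwa [div_le_iff₀' (by positivity)] at this
  let Λ : Polynomial ℝ →ₗ[ℝ] ℂ :=
    { toFun := fun p => ∫ x : ℝ, ((p.eval x : ℝ) : ℂ) * w x
      map_add' := fun p q => by
        rw [← integral_add (hint p) (hint q)]
        simp [add_mul]
      map_smul' := fun a p => by
        simp [mul_assoc, integral_const_mul] }
  have hΛ : Λ = 0 := by
    refine LinearMap.ext_on_range span_hermitePoly fun n => ?_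
    have hn := h n
    have e : ∀ x, u x * hermiteFun n x =
        ((((hermitePoly n).eval x : ℝ) : ℂ) * w x) / (Real.sqrt (hermiteGamma n) : ℂ) := by
      intro x
      simp only [hermiteFun, hw]
      push_cast
      ring
    simp_rw [e] at hn
    rw [integral_div, div_eq_zero_iff, or_iff_left] at hn
    · exact hn
    · exact_mod_cast (Real.sqrt_pos.2 (hermiteGamma_pos n)).ne'
  have hw0 : w =ᵐ[volume] 0 := by
    refine ae_eq_zero_of_moments_eq_zero hwm hexp fun k => ?_
    have := LinearMap.congr_fun hΛ (Polynomial.X ^ k)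
    simpa [Λ] using this
  filter_upwards [hw0] with x hx
  simpa [hw, -Complex.ofReal_exp, (Real.exp_pos _).ne'] using hx

/-- The Hermite functions as a Hilbert basis of `L²(ℝ)`. -/
noncomputable def hermiteBasis : HilbertBasis ℕ ℂ (Lp ℂ 2 (volume : Measure ℝ)) :=
  HilbertBasis.mkOfOrthogonalEqBot orthonormal_hermiteFun <| by
    rw [Submodule.eq_bot_iff]
    intro v hv
    have hv' : v = (Lp.memLp v).toLp v := (Lp.toLp_coeFn v (Lp.memLp v)).symm
    have h0 := eq_zero_of_integral_mul_hermiteFun_eq_zero (Lp.memLp v) fun n => by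
      rw [← integral_mul_hermiteFun_eq_inner (Lp.memLp v), ← hv']
      exact hv _ (Submodule.subset_span ⟨n, rfl⟩)
    exact (Lp.eq_zero_iff_ae_eq_zero).2 h0

/-- Parseval's identity for the Hermite functions. -/
theorem hasSum_norm_sq_integral_mul_hermiteFun {u : ℝ → ℂ} (hu : MemLp u 2) :
    HasSum (fun n => ‖∫ x, u x * hermiteFun n x‖ ^ 2) (∫ x, ‖u x‖ ^ 2) := by
  have h := hermiteBasis.hasSum_inner_mul_inner (hu.toLp u) (hu.toLp u)
  have hb : ∀ n, hermiteBasis n = (memLp_hermiteFun n).toLp (hermiteFun n) := fun n => by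
    simp [hermiteBasis]
  have h2 := Complex.reCLM.hasSum h
  have e1 : ∫ x, ‖u x‖ ^ 2 = Complex.reCLM (inner ℂ (hu.toLp u) (hu.toLp u)) := by
    rw [L2.inner_def, Complex.reCLM_apply]
    have : ∫ x, inner ℂ (hu.toLp u x) (hu.toLp u x) = ((∫ x, ‖u x‖ ^ 2 : ℝ) : ℂ) := by
      rw [← integral_complex_ofReal]
      refine integral_congr_ae ?_
      filter_upwards [hu.coeFn_toLp] with x hx
      rw [hx, inner_self_eq_norm_sq_to_K]
      simp
    rw [this, Complex.ofReal_re]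
  rw [e1]
  convert h2 using 2 with n
  rw [← integral_mul_hermiteFun_eq_inner hu, hb, ← inner_conj_symm (hu.toLp u), mul_comm,
    Complex.mul_conj, Complex.reCLM_apply, Complex.ofReal_re, Complex.normSq_eq_norm_sq]

theorem MemL2Weight.memLp {g : ℝ → ℂ} (hg : MemL2Weight g) :
    MemLp (fun x => g x * (Real.exp (-(1 / 2) * x ^ 2) : ℂ)) 2 := by
  rw [memLp_two_iff_integrable_sq_norm
    (hg.1.fun_mul (Continuous.aestronglyMeasurable (by fun_prop)))]
  refine hg.2.congr (ae_of_all _ fun x => ?_)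
  simp only [norm_mul, Complex.norm_real, Real.norm_eq_abs, Real.abs_exp]
  rw [← exp_neg_half_sq_mul_self]
  ring

theorem integral_mul_hermiteFun_eq_hermiteCoeff (g : ℝ → ℂ) (n : ℕ) :
    ∫ x, g x * (Real.exp (-(1 / 2) * x ^ 2) : ℂ) * hermiteFun n x =
      hermiteCoeff g n * (Real.sqrt (hermiteGamma n) : ℂ) := by
  have hpos := Real.sqrt_pos.2 (hermiteGamma_pos n)
  have h1 : (Real.sqrt (hermiteGamma n) : ℂ) ≠ 0 := by exact_mod_cast hpos.ne'
  have h2 : (hermiteGamma n : ℂ) = Real.sqrt (hermiteGamma n) * Real.sqrt (hermiteGamma n) := by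
    rw [← Complex.ofReal_mul, Real.mul_self_sqrt (hermiteGamma_pos n).le]
  rw [hermiteCoeff, h2]
  have e : ∀ x, g x * (Real.exp (-(1 / 2) * x ^ 2) : ℂ) * hermiteFun n x =
      (g x * (hermiteH n x : ℂ) * (hermiteWeight x : ℂ)) / (Real.sqrt (hermiteGamma n) : ℂ) := by
    intro x
    rw [hermiteFun, hermiteH_eq_eval, ← exp_neg_half_sq_mul_self]
    push_cast
    ring
  simp_rw [e]
  rw [integral_div]
  field_simp

theorem integral_hermiteFun_mul (m n : ℕ) :
    ∫ x, hermiteFun m x * hermiteFun n x = if n = m then 1 else 0 := by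
  rw [← integral_mul_hermiteFun_eq_inner (memLp_hermiteFun m)]
  exact orthonormal_iff_ite.1 orthonormal_hermiteFun n m

/-- Parseval's identity for the error of the Hermite projection. -/
theorem hasSum_normL2Weight_sub_hermiteProj_sq {g : ℝ → ℂ} (hg : MemL2Weight g) (n : ℕ) :
    HasSum (fun k => ‖hermiteCoeff g (k + (n + 1))‖ ^ 2 * hermiteGamma (k + (n + 1)))
      (normL2Weight (fun x => g x - hermiteProj n g x) ^ 2) := by
  set u : ℝ → ℂ := fun x => g x * (Real.exp (-(1 / 2) * x ^ 2) : ℂ) with hu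
  have hum : MemLp u 2 := hg.memLp
  set c : ℕ → ℂ := fun k => hermiteCoeff g k * (Real.sqrt (hermiteGamma k) : ℂ) with hc
  set v : ℝ → ℂ := fun x => u x - ∑ k ∈ Finset.range (n + 1), c k * hermiteFun k x with hv
  have hvm : MemLp v 2 := hum.sub
    (memLp_finsetSum _ fun k _ => (memLp_hermiteFun k).const_mul (c k))
  have hvg : ∀ x, ‖v x‖ ^ 2 = ‖g x - hermiteProj n g x‖ ^ 2 * hermiteWeight x := by
    intro x
    have : v x = (g x - hermiteProj n g x) * (Real.exp (-(1 / 2) * x ^ 2) : ℂ) := by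
      simp only [hv, hu, hermiteProj, sub_mul, Finset.sum_mul]
      congr 1
      refine Finset.sum_congr rfl fun k _ => ?_
      have h1 : (Real.sqrt (hermiteGamma k) : ℂ) ≠ 0 := by
        exact_mod_cast (Real.sqrt_pos.2 (hermiteGamma_pos k)).ne'
      rw [hermiteFun, hermiteH_eq_eval]
      simp only [hc]
      push_cast
      field_simp
    rw [this, norm_mul, mul_pow, Complex.norm_real, Real.norm_eq_abs, Real.abs_exp,
      ← exp_neg_half_sq_mul_self, sq (Real.exp _)]
  have hnorm : normL2Weight (fun x => g x - hermiteProj n g x) ^ 2 = ∫ x, ‖v x‖ ^ 2 := by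
    rw [normL2Weight, Real.sq_sqrt]
    · simp_rw [hvg]
    · exact integral_nonneg fun x => mul_nonneg (sq_nonneg _) (hermiteWeight_pos x).le
  have hcoef : ∀ k, ∫ x, v x * hermiteFun k x = if k < n + 1 then 0 else c k := by
    intro k
    have hI : ∀ j, Integrable fun x => hermiteFun j x * hermiteFun k x := fun j =>
      (memLp_hermiteFun j).integrable_mul (memLp_hermiteFun k)
    have hIu : Integrable fun x => u x * hermiteFun k x := hum.integrable_mul (memLp_hermiteFun k)
    simp only [hv, sub_mul, Finset.sum_mul, mul_assoc]
    rw [integral_sub hIu (integrable_finsetSum _ fun j _ => (hI j).const_mul _),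
      integral_finsetSum _ fun j _ => (hI j).const_mul _]
    simp_rw [integral_const_mul, integral_hermiteFun_mul]
    have h1 : ∫ x, u x * hermiteFun k x = c k := integral_mul_hermiteFun_eq_hermiteCoeff g k
    rw [h1]
    simp only [mul_ite, mul_one, mul_zero, Finset.sum_ite_eq, Finset.mem_range]
    split_ifs <;> simp
  have hS := hasSum_norm_sq_integral_mul_hermiteFun hvm
  rw [← hnorm, ← hasSum_nat_add_iff' (n + 1)] at hS
  have h0 : ∑ i ∈ Finset.range (n + 1), ‖∫ x, v x * hermiteFun i x‖ ^ 2 = 0 :=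
    Finset.sum_eq_zero fun k hk => by rw [hcoef, if_pos (Finset.mem_range.1 hk)]; simp
  rw [h0, sub_zero] at hS
  refine hS.congr_fun fun k => ?_
  rw [hcoef, if_neg (by omega), norm_mul, mul_pow, Complex.norm_real,
    Real.norm_of_nonneg (Real.sqrt_nonneg _), Real.sq_sqrt (hermiteGamma_pos _).le]

/-! ### Fourier representation of the derivatives of the Gaussian -/

/-- The half-line Fourier integral `G_n(z) = ∫_0^∞ tⁿ exp (-t²/4 + i t z) dt`. -/
noncomputable def gaussHalf (n : ℕ) (z : ℂ) : ℂ :=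
  ∫ t in Set.Ioi (0 : ℝ), (t : ℂ) ^ n * Complex.exp (-(t : ℂ) ^ 2 / 4 + Complex.I * t * z)

theorem norm_gaussHalf_integrand (n : ℕ) (z : ℂ) (t : ℝ) :
    ‖(t : ℂ) ^ n * Complex.exp (-(t : ℂ) ^ 2 / 4 + Complex.I * t * z)‖ =
      |t| ^ n * Real.exp (-t ^ 2 / 4 - t * z.im) := by
  rw [norm_mul, norm_pow, Complex.norm_real, Real.norm_eq_abs, Complex.norm_exp]
  congr 2
  have : (-(t : ℂ) ^ 2 / 4) = ((-t ^ 2 / 4 : ℝ) : ℂ) := by push_cast; ring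
  rw [this, Complex.add_re, Complex.ofReal_re, Complex.mul_re]
  simp
  ring

theorem norm_gaussHalf_integrand_le (n : ℕ) {z : ℂ} {c : ℝ} (hz : |z.im| ≤ c) (t : ℝ) :
    ‖(t : ℂ) ^ n * Complex.exp (-(t : ℂ) ^ 2 / 4 + Complex.I * t * z)‖ ≤
      |t| ^ n * (Real.exp (c * |t|) * Real.exp (-(1 / 4) * t ^ 2)) := by
  rw [norm_gaussHalf_integrand, ← Real.exp_add]
  gcongr
  have h1 : -(t * z.im) ≤ |t| * |z.im| := by rw [← abs_mul]; exact neg_le_abs _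
  have h2 : |t| * |z.im| ≤ |t| * c := by gcongr
  linarith

theorem integrable_gaussHalf_integrand (n : ℕ) (z : ℂ) :
    Integrable fun t : ℝ =>
      (t : ℂ) ^ n * Complex.exp (-(t : ℂ) ^ 2 / 4 + Complex.I * t * z) :=
  (integrable_abs_pow_mul_exp_abs_mul_exp_neg_sq (by norm_num : (0 : ℝ) < 1 / 4) |z.im| n).mono'
    (Continuous.aestronglyMeasurable (by fun_prop))
    (ae_of_all _ fun t => norm_gaussHalf_integrand_le n le_rfl t)

theorem hasDerivAt_gaussHalf (n : ℕ) (z : ℂ) :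
    HasDerivAt (gaussHalf n) (Complex.I * gaussHalf (n + 1) z) z := by
  have hs : Metric.ball z 1 ∈ 𝓝 z := Metric.ball_mem_nhds z one_pos
  have h := (hasDerivAt_integral_of_dominated_loc_of_deriv_le
    (μ := volume.restrict (Set.Ioi (0 : ℝ)))
    (F := fun (z : ℂ) (t : ℝ) =>
      (t : ℂ) ^ n * Complex.exp (-(t : ℂ) ^ 2 / 4 + Complex.I * t * z))
    (F' := fun (z : ℂ) (t : ℝ) =>
      Complex.I * ((t : ℂ) ^ (n + 1) * Complex.exp (-(t : ℂ) ^ 2 / 4 + Complex.I * t * z)))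
    (bound := fun t : ℝ =>
      |t| ^ (n + 1) * (Real.exp ((|z.im| + 1) * |t|) * Real.exp (-(1 / 4) * t ^ 2)))
    hs (Eventually.of_forall fun w => Continuous.aestronglyMeasurable (by fun_prop))
    (integrable_gaussHalf_integrand n z).integrableOn
    (Continuous.aestronglyMeasurable (by fun_prop)) ?_
    (integrable_abs_pow_mul_exp_abs_mul_exp_neg_sq (by norm_num) _ _).integrableOn ?_).2
  · rw [integral_const_mul] at h
    exact h
  · refine ae_of_all _ fun t w hw => ?_
    rw [norm_mul, Complex.norm_I, one_mul]
    refine norm_gaussHalf_integrand_le (n + 1) ?_ t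
    have h1 : |(w - z).im| ≤ ‖w - z‖ := Complex.abs_im_le_norm _
    rw [Metric.mem_ball, dist_eq_norm] at hw
    have h2 : |w.im| ≤ |z.im| + |(w - z).im| := by
      have := abs_add_le z.im (w - z).im
      simpa using this
    linarith
  · refine ae_of_all _ fun t w _ => ?_
    have h1 : HasDerivAt (fun w : ℂ => -(t : ℂ) ^ 2 / 4 + Complex.I * t * w) (Complex.I * t) w := by
      simpa using ((hasDerivAt_id w).const_mul (Complex.I * (t : ℂ))).const_add (-(t : ℂ) ^ 2 / 4)
    refine (h1.cexp.const_mul ((t : ℂ) ^ n)).congr_deriv ?_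
    ring

theorem continuous_gaussHalf (n : ℕ) : Continuous (gaussHalf n) :=
  continuous_iff_continuousAt.2 fun z => (hasDerivAt_gaussHalf n z).continuousAt

theorem gaussHalf_zero_add (x : ℝ) :
    gaussHalf 0 x + gaussHalf 0 (-x) = 2 * Real.sqrt Real.pi * hermiteWeight x := by
  have hI := integrable_gaussHalf_integrand 0 x
  have h1 : gaussHalf 0 (-x) = ∫ t in Set.Iic (0 : ℝ),
      (t : ℂ) ^ 0 * Complex.exp (-(t : ℂ) ^ 2 / 4 + Complex.I * t * x) := by
    have := integral_comp_neg_Ioi (0 : ℝ) fun t : ℝ =>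
      (t : ℂ) ^ 0 * Complex.exp (-(t : ℂ) ^ 2 / 4 + Complex.I * t * x)
    rw [neg_zero] at this
    rw [← this, gaussHalf]
    simp
  rw [h1, gaussHalf, add_comm, intervalIntegral.integral_Iic_add_Ioi hI.integrableOn
    hI.integrableOn]
  have h2 := integral_cexp_quadratic (b := -(1 / 4)) (by norm_num) (Complex.I * x) 0
  have e : ∀ t : ℝ, (t : ℂ) ^ 0 * Complex.exp (-(t : ℂ) ^ 2 / 4 + Complex.I * t * x) =
      Complex.exp (-(1 / 4) * (t : ℂ) ^ 2 + Complex.I * x * t + 0) := by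
    intro t
    rw [pow_zero, one_mul]
    congr 1
    ring
  simp_rw [e]
  rw [h2]
  congr 1
  · have h3 : ((Real.pi : ℂ) / - -(1 / 4)) = ((4 * Real.pi : ℝ) : ℂ) := by push_cast; ring
    rw [h3, show (1 / 2 : ℂ) = ((1 / 2 : ℝ) : ℂ) by push_cast; rfl,
      ← Complex.ofReal_cpow (by positivity), ← Real.sqrt_eq_rpow, Real.sqrt_mul (by norm_num),
      show (4 : ℝ) = 2 ^ 2 by norm_num, Real.sqrt_sq (by norm_num)]
    push_cast; ring
  · rw [hermiteWeight, Complex.ofReal_exp]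
    congr 1
    push_cast
    rw [mul_pow, Complex.I_sq]
    ring

/-- The derivatives of the Gaussian weight as Fourier integrals, split at frequency zero. -/
theorem iteratedDeriv_hermiteWeight_eq_gaussHalf (n : ℕ) (x : ℝ) :
    2 * Real.sqrt Real.pi * ((iteratedDeriv n hermiteWeight x : ℝ) : ℂ) =
      Complex.I ^ n * gaussHalf n x + (-Complex.I) ^ n * gaussHalf n (-x) := by
  induction n generalizing x with
  | zero => simp [← gaussHalf_zero_add]
  | succ n ih =>
    have hR : HasDerivAt (iteratedDeriv n hermiteWeight) (iteratedDeriv (n + 1) hermiteWeight x)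
        x := by
      rw [iteratedDeriv_succ, hasDerivAt_deriv_iff, iteratedDeriv_hermiteWeight]
      exact ((hasDerivAt_eval_mul_hermiteWeight (hermitePoly n) x).const_mul _).differentiableAt
    have h1 := (hR.ofReal_comp).const_mul (2 * Real.sqrt Real.pi : ℂ)
    have h2 := ((hasDerivAt_gaussHalf n (x : ℂ)).comp_ofReal.const_mul (Complex.I ^ n)).add
      (((hasDerivAt_gaussHalf n (-(x : ℂ))).scomp (x : ℂ)
        (hasDerivAt_neg (x : ℂ))).comp_ofReal.const_mul ((-Complex.I) ^ n))
    have h3 : (fun y : ℝ => 2 * Real.sqrt Real.pi * ((iteratedDeriv n hermiteWeight y : ℝ) : ℂ)) =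
        fun y : ℝ => Complex.I ^ n * gaussHalf n y + (-Complex.I) ^ n * gaussHalf n (-y) :=
      funext ih
    rw [h3] at h1
    rw [h1.unique h2]
    simp only [smul_eq_mul]
    ring

theorem gaussHalf_apply_zero (n : ℕ) :
    gaussHalf n 0 = ((2 ^ n * Real.Gamma (((n : ℝ) + 1) / 2) : ℝ) : ℂ) := by
  have h := integral_rpow_mul_exp_neg_mul_rpow (p := 2) (q := n) (b := 1 / 4) (by norm_num)
    (by linarith [n.cast_nonneg (α := ℝ)]) (by norm_num)
  have e : ∀ t : ℝ, (t : ℂ) ^ n * Complex.exp (-(t : ℂ) ^ 2 / 4 + Complex.I * t * 0) =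
      ((t ^ (n : ℝ) * Real.exp (-(1 / 4) * t ^ (2 : ℝ)) : ℝ) : ℂ) := by
    intro t
    rw [Real.rpow_natCast, Real.rpow_ofNat]
    push_cast
    congr 2
    ring
  rw [gaussHalf]
  simp_rw [e]
  rw [integral_complex_ofReal, h]
  congr 2
  rw [show (1 / 4 : ℝ) = 2 ^ (-2 : ℝ) by norm_num [Real.rpow_neg], ← Real.rpow_mul (by norm_num),
    show (-2 : ℝ) * (-((n : ℝ) + 1) / 2) = (n : ℝ) + 1 by ring, Real.rpow_add_one (by norm_num),
    Real.rpow_natCast]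
  ring

/-! ### The saddle-point asymptotics of the half-line Fourier integral -/

/-- The saddle point `√(2n)` of `tⁿ exp (-t²/4)`. -/
noncomputable def saddle (n : ℕ) : ℝ := Real.sqrt (2 * n)

theorem saddle_sq (n : ℕ) : saddle n ^ 2 = 2 * n := Real.sq_sqrt (by positivity)

theorem one_le_saddle {n : ℕ} (hn : 1 ≤ n) : 1 ≤ saddle n := by
  rw [saddle, Real.one_le_sqrt]
  have : (1 : ℝ) ≤ n := by exact_mod_cast hn
  linarith

theorem tendsto_saddle : Tendsto saddle atTop atTop :=
  Real.tendsto_sqrt_atTop.comp (tendsto_natCast_atTop_atTop.const_mul_atTop two_pos)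

/-- The integrand `s^k (1 + s/T)^(n-j) exp (-T s/2 - s²/4 + i s z)`, `T = √(2n)`, obtained for
`j = k = 0` by centring `tⁿ exp (-t²/4 + i t z)` at its saddle point `T`; the other indices are
those produced by differentiation. -/
noncomputable def saddleIntegrand (n j k : ℕ) (z : ℂ) (s : ℝ) : ℂ :=
  (s : ℂ) ^ k * (1 + s / saddle n) ^ (n - j) *
    Complex.exp (-(saddle n * s / 2) - (s : ℂ) ^ 2 / 4 + Complex.I * s * z)

/-- The integral of `saddleIntegrand` over `s > -√(2n)`. -/
noncomputable def saddleIntegral (n j k : ℕ) (z : ℂ) : ℂ :=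
  ∫ s in Set.Ioi (-saddle n), saddleIntegrand n j k z s

theorem continuous_saddleIntegrand (n j k : ℕ) (z : ℂ) :
    Continuous (saddleIntegrand n j k z) := by
  unfold saddleIntegrand; fun_prop

/-- The substitution `t = √(2n) + s`. -/
theorem gaussHalf_eq_saddleIntegral {n : ℕ} (hn : 1 ≤ n) (z : ℂ) :
    gaussHalf n z = ((saddle n ^ n * Real.exp (-(saddle n ^ 2 / 4)) : ℝ) : ℂ) *
      Complex.exp (Complex.I * saddle n * z) * saddleIntegral n 0 0 z := by
  have hT : 0 < saddle n := one_pos.trans_le (one_le_saddle hn)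
  have hTc : (saddle n : ℂ) ≠ 0 := by exact_mod_cast hT.ne'
  have h := (measurePreserving_add_right volume (saddle n)).setIntegral_preimage_emb
    (measurableEmbedding_addRight (saddle n))
    (fun t : ℝ => (t : ℂ) ^ n * Complex.exp (-(t : ℂ) ^ 2 / 4 + Complex.I * t * z)) (Set.Ioi 0)
  rw [gaussHalf, ← h, saddleIntegral, ← integral_const_mul]
  have hset : (fun x => x + saddle n) ⁻¹' Set.Ioi 0 = Set.Ioi (-saddle n) := by
    ext x; simp [neg_lt_iff_pos_add]
  rw [hset]
  congr 1
  ext s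
  rw [saddleIntegrand, pow_zero, one_mul, Nat.sub_zero]
  have e1 : ((s + saddle n : ℝ) : ℂ) ^ n = (saddle n : ℂ) ^ n * (1 + s / saddle n) ^ n := by
    rw [← mul_pow]
    congr 1
    push_cast
    field_simp
    ring
  rw [e1]
  have e2 : Complex.exp (-((s + saddle n : ℝ) : ℂ) ^ 2 / 4 +
      Complex.I * ((s + saddle n : ℝ) : ℂ) * z) =
      Complex.exp (-(saddle n ^ 2 / 4)) * Complex.exp (Complex.I * saddle n * z) *
      Complex.exp (-(saddle n * s / 2) - (s : ℂ) ^ 2 / 4 + Complex.I * s * z) := by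
    rw [← Complex.exp_add, ← Complex.exp_add]
    congr 1
    push_cast
    ring
  rw [e2]
  push_cast
  ring

theorem norm_saddleIntegrand (n j k : ℕ) (z : ℂ) {s : ℝ} (hs : 0 ≤ 1 + s / saddle n) :
    ‖saddleIntegrand n j k z s‖ = |s| ^ k * ((1 + s / saddle n) ^ (n - j) *
      Real.exp (-(saddle n * s / 2) - s ^ 2 / 4 - s * z.im)) := by
  rw [saddleIntegrand, norm_mul, norm_mul, norm_pow, norm_pow, Complex.norm_real,
    Real.norm_eq_abs, Complex.norm_exp, mul_assoc]
  congr 2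
  · rw [← Complex.ofReal_div, ← Complex.ofReal_one, ← Complex.ofReal_add, Complex.norm_real,
      Real.norm_of_nonneg hs]
  · congr 1
    have : (-(saddle n * s / 2 : ℂ) - (s : ℂ) ^ 2 / 4) =
        ((-(saddle n * s / 2) - s ^ 2 / 4 : ℝ) : ℂ) := by push_cast; ring
    rw [this, Complex.add_re, Complex.ofReal_re, Complex.mul_re]
    simp
    ring

theorem one_add_div_saddle_nonneg {n : ℕ} (hn : 1 ≤ n) {s : ℝ} (hs : s ∈ Set.Ioi (-saddle n)) :
    0 ≤ 1 + s / saddle n := by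
  have hT : 0 < saddle n := one_pos.trans_le (one_le_saddle hn)
  have hs' : -saddle n < s := hs
  have : -1 ≤ s / saddle n := by rw [le_div_iff₀ hT]; linarith
  linarith

/-- The inequality `1 + u ≤ exp u` bounds the integrand uniformly in `n`. -/
theorem norm_saddleIntegrand_le {n j : ℕ} (k : ℕ) (hn : 1 ≤ n) (hj : j ≤ n) {z : ℂ} {c : ℝ}
    (hz : |z.im| ≤ c) {s : ℝ} (hs : s ∈ Set.Ioi (-saddle n)) :
    ‖saddleIntegrand n j k z s‖ ≤
      |s| ^ k * (Real.exp ((j + c) * |s|) * Real.exp (-(1 / 4) * s ^ 2)) := by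
  have h1T := one_le_saddle hn
  have hT : 0 < saddle n := one_pos.trans_le h1T
  have h0 := one_add_div_saddle_nonneg hn hs
  rw [norm_saddleIntegrand n j k z h0]
  gcongr _ * ?_
  have h1 : (1 + s / saddle n) ^ (n - j) ≤ Real.exp ((n - j : ℝ) * (s / saddle n)) := by
    rw [← Nat.cast_sub hj, Real.exp_nat_mul]
    gcongr
    rw [add_comm]; exact Real.add_one_le_exp _
  refine (mul_le_mul_of_nonneg_right h1 (Real.exp_pos _).le).trans ?_
  rw [← Real.exp_add, ← Real.exp_add, Real.exp_le_exp]
  have h2 : (n : ℝ) * (s / saddle n) = saddle n * s / 2 := by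
    have := saddle_sq n
    field_simp
    linear_combination (-s) * this
  have h3 : -((j : ℝ) * (s / saddle n)) ≤ j * |s| := by
    rw [← mul_neg]
    gcongr
    rw [← neg_div, div_le_iff₀ hT]
    calc -s ≤ |s| * 1 := by rw [mul_one]; exact neg_le_abs s
      _ ≤ |s| * saddle n := by gcongr
  have h4 : -(s * z.im) ≤ c * |s| := by
    calc -(s * z.im) ≤ |s| * |z.im| := by rw [← abs_mul]; exact neg_le_abs _
      _ ≤ |s| * c := by gcongr
      _ = c * |s| := mul_comm _ _
  rw [sub_mul, h2]
  linarith

theorem integrableOn_saddleIntegrand {n j : ℕ} (k : ℕ) (hn : 1 ≤ n) (hj : j ≤ n) (z : ℂ) :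
    IntegrableOn (saddleIntegrand n j k z) (Set.Ioi (-saddle n)) := by
  refine Integrable.mono' (integrable_abs_pow_mul_exp_abs_mul_exp_neg_sq
    (by norm_num : (0 : ℝ) < 1 / 4) (j + |z.im|) k).integrableOn
    (continuous_saddleIntegrand n j k z).aestronglyMeasurable ?_
  filter_upwards [ae_restrict_mem measurableSet_Ioi] with s hs
  exact norm_saddleIntegrand_le k hn hj le_rfl hs

theorem norm_saddleIntegral_le {n j : ℕ} (k : ℕ) (hn : 1 ≤ n) (hj : j ≤ n) {z : ℂ} {c : ℝ}
    (hz : |z.im| ≤ c) : ‖saddleIntegral n j k z‖ ≤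
      ∫ s : ℝ, |s| ^ k * (Real.exp ((j + c) * |s|) * Real.exp (-(1 / 4) * s ^ 2)) := by
  have hI := integrable_abs_pow_mul_exp_abs_mul_exp_neg_sq
    (by norm_num : (0 : ℝ) < 1 / 4) (j + c) k
  refine (norm_integral_le_of_norm_le hI.integrableOn ?_).trans
    (setIntegral_le_integral hI (ae_of_all _ fun s => by positivity))
  filter_upwards [ae_restrict_mem measurableSet_Ioi] with s hs
  exact norm_saddleIntegrand_le k hn hj hz hs

theorem hasDerivAt_saddleIntegrand {n j : ℕ} (k : ℕ) (hj : j + 1 ≤ n) (z : ℂ) (s : ℝ) :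
    HasDerivAt (saddleIntegrand n j k z)
      (k * saddleIntegrand n j (k - 1) z s - 1 / 2 * saddleIntegrand n (j + 1) (k + 1) z s
        - j / saddle n * saddleIntegrand n (j + 1) k z s
        - 1 / 2 * saddleIntegrand n j (k + 1) z s
        + Complex.I * z * saddleIntegrand n j k z s) s := by
  have hn : 1 ≤ n := by omega
  have hT : 0 < saddle n := one_pos.trans_le (one_le_saddle hn)
  have hTc : (saddle n : ℂ) ≠ 0 := by exact_mod_cast hT.ne'
  have hT2 : (saddle n : ℂ) ^ 2 = 2 * n := by exact_mod_cast saddle_sq n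
  have hid := hasDerivAt_id (s : ℂ)
  have h1 : HasDerivAt (fun w : ℂ => w ^ k) (k * (s : ℂ) ^ (k - 1)) s := hasDerivAt_pow k _
  have h2 : HasDerivAt (fun w : ℂ => (1 + w / saddle n) ^ (n - j))
      (((n - j : ℕ) : ℂ) * (1 + s / saddle n) ^ (n - j - 1) * (1 / saddle n)) s :=
    ((hid.div_const (saddle n : ℂ)).const_add 1).fun_pow (n - j)
  have h3 : HasDerivAt (fun w : ℂ =>
      Complex.exp (-(saddle n * w / 2) - w ^ 2 / 4 + Complex.I * w * z))
      (Complex.exp (-(saddle n * s / 2) - (s : ℂ) ^ 2 / 4 + Complex.I * s * z) *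
        (-(saddle n * 1 / 2) - (2 * (s : ℂ)) / 4 + Complex.I * 1 * z)) s := by
    have hsq : HasDerivAt (fun w : ℂ => w ^ 2) (2 * (s : ℂ)) s := by
      simpa using hasDerivAt_pow 2 (s : ℂ)
    exact ((((hid.const_mul (saddle n : ℂ)).div_const 2).neg.sub (hsq.div_const 4)).add
      ((hid.const_mul Complex.I).mul_const z)).cexp
  refine ((h1.mul h2).mul h3).comp_ofReal.congr_deriv ?_
  obtain ⟨m, rfl⟩ : ∃ m, n = j + 1 + m := ⟨n - (j + 1), by omega⟩
  have e1 : j + 1 + m - j = m + 1 := by omega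
  have e2 : j + 1 + m - (j + 1) = m := by omega
  simp only [saddleIntegrand, Pi.mul_apply, e1, e2, Nat.add_sub_cancel]
  set E := Complex.exp (-(saddle (j + 1 + m) * s / 2) - (s : ℂ) ^ 2 / 4 + Complex.I * s * z)
  set T : ℂ := (saddle (j + 1 + m) : ℂ)
  push_cast at hT2 ⊢
  -- the identity `T² = 2n` cancels the terms of order `T` in the logarithmic derivative
  have hm : (m : ℂ) + 1 = T ^ 2 / 2 - j := by linear_combination -hT2 / 2
  rw [hm, pow_succ (1 + (s : ℂ) / T) m]
  field_simp
  ring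

/-- Integration by parts; the boundary term at `s = -√(2n)` vanishes because `j < n`. -/
theorem mul_saddleIntegral {n j : ℕ} (k : ℕ) (hj : j + 1 ≤ n) (z : ℂ) :
    Complex.I * z * saddleIntegral n j k z =
      -(k * saddleIntegral n j (k - 1) z - 1 / 2 * saddleIntegral n (j + 1) (k + 1) z
        - j / saddle n * saddleIntegral n (j + 1) k z
        - 1 / 2 * saddleIntegral n j (k + 1) z) := by
  have hn : 1 ≤ n := by omega
  have hT : 0 < saddle n := one_pos.trans_le (one_le_saddle hn)
  have hTc : (saddle n : ℂ) ≠ 0 := by exact_mod_cast hT.ne'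
  have i1 := (integrableOn_saddleIntegrand (k - 1) hn (by omega : j ≤ n) z).const_mul (k : ℂ)
  have i2 := (integrableOn_saddleIntegrand (k + 1) hn hj z).const_mul (1 / 2 : ℂ)
  have i3 := (integrableOn_saddleIntegrand k hn hj z).const_mul (j / saddle n : ℂ)
  have i4 := (integrableOn_saddleIntegrand (k + 1) hn (by omega : j ≤ n) z).const_mul (1 / 2 : ℂ)
  have i0 := integrableOn_saddleIntegrand k hn (by omega : j ≤ n) z
  have i5 := i0.const_mul (Complex.I * z)
  have hd := fun s (_ : s ∈ Set.Ici (-saddle n)) => hasDerivAt_saddleIntegrand k hj z s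
  have hint := (((i1.sub' i2).sub' i3).sub' i4).fun_add i5
  have h := integral_Ioi_of_hasDerivAt_of_tendsto' hd hint
    (tendsto_zero_of_hasDerivAt_of_integrableOn_Ioi (fun s hs => hd s (Set.mem_Ioi.1 hs).le)
      hint i0)
  have h0 : saddleIntegrand n j k z (-saddle n) = 0 := by
    rw [saddleIntegrand]
    have : (1 + ((-saddle n : ℝ) : ℂ) / saddle n) = 0 := by
      push_cast; field_simp; ring
    rw [this, zero_pow (by omega)]
    ring
  rw [integral_add (((i1.sub' i2).sub' i3).sub' i4) i5,
    integral_sub ((i1.sub' i2).sub' i3) i4, integral_sub (i1.sub' i2) i3,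
    integral_sub i1 i2, integral_const_mul, integral_const_mul,
    integral_const_mul, integral_const_mul, integral_const_mul, h0, sub_zero] at h
  simp only [saddleIntegral]
  linear_combination h

/-- Repeated integration by parts: the saddle integrals decay faster than any power of `z` in a
strip, uniformly in `n`. -/
theorem exists_pow_mul_norm_saddleIntegral_le (c : ℝ) (m j k : ℕ) :
    ∃ C : ℝ, ∀ n : ℕ, m + j + 1 ≤ n → ∀ z : ℂ, |z.im| ≤ c →
      ‖z‖ ^ m * ‖saddleIntegral n j k z‖ ≤ C := by
  induction m generalizing j k with
  | zero =>
    refine ⟨∫ s : ℝ, |s| ^ k * (Real.exp ((j + c) * |s|) * Real.exp (-(1 / 4) * s ^ 2)),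
      fun n hn z hz => ?_⟩
    rw [pow_zero, one_mul]
    exact norm_saddleIntegral_le k (by omega) (by omega) hz
  | succ m ih =>
    obtain ⟨C1, h1⟩ := ih j (k - 1)
    obtain ⟨C2, h2⟩ := ih (j + 1) (k + 1)
    obtain ⟨C3, h3⟩ := ih (j + 1) k
    obtain ⟨C4, h4⟩ := ih j (k + 1)
    refine ⟨k * C1 + 1 / 2 * C2 + j * C3 + 1 / 2 * C4, fun n hn z hz => ?_⟩
    have hT : 1 ≤ saddle n := one_le_saddle (by omega)
    have key : ‖z‖ * ‖saddleIntegral n j k z‖ ≤ k * ‖saddleIntegral n j (k - 1) z‖ +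
        1 / 2 * ‖saddleIntegral n (j + 1) (k + 1) z‖ + j * ‖saddleIntegral n (j + 1) k z‖ +
        1 / 2 * ‖saddleIntegral n j (k + 1) z‖ := by
      have h := congrArg norm (mul_saddleIntegral k (by omega : j + 1 ≤ n) z)
      rw [norm_mul, norm_mul, Complex.norm_I, one_mul, norm_neg] at h
      rw [h]
      refine (norm_sub_le _ _).trans (add_le_add ((norm_sub_le _ _).trans
        (add_le_add ((norm_sub_le _ _).trans (add_le_add ?_ ?_)) ?_)) ?_)
      · rw [norm_mul, Complex.norm_natCast]
      · rw [norm_mul]; norm_num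
      · rw [norm_mul, norm_div, Complex.norm_natCast, Complex.norm_real,
          Real.norm_of_nonneg (by linarith)]
        gcongr
        exact div_le_self (by positivity) hT
      · rw [norm_mul]; norm_num
    have p := pow_nonneg (norm_nonneg z) m
    calc ‖z‖ ^ (m + 1) * ‖saddleIntegral n j k z‖
        = ‖z‖ ^ m * (‖z‖ * ‖saddleIntegral n j k z‖) := by ring
      _ ≤ ‖z‖ ^ m * (k * ‖saddleIntegral n j (k - 1) z‖ +
        1 / 2 * ‖saddleIntegral n (j + 1) (k + 1) z‖ + j * ‖saddleIntegral n (j + 1) k z‖ +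
        1 / 2 * ‖saddleIntegral n j (k + 1) z‖) := by gcongr
      _ = k * (‖z‖ ^ m * ‖saddleIntegral n j (k - 1) z‖) +
        1 / 2 * (‖z‖ ^ m * ‖saddleIntegral n (j + 1) (k + 1) z‖) +
        j * (‖z‖ ^ m * ‖saddleIntegral n (j + 1) k z‖) +
        1 / 2 * (‖z‖ ^ m * ‖saddleIntegral n j (k + 1) z‖) := by ring
      _ ≤ _ := by
        gcongr
        · exact h1 n (by omega) z hz
        · exact h2 n (by omega) z hz
        · exact h3 n (by omega) z hz
        · exact h4 n (by omega) z hz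

/-- `(1 + s/T)ⁿ exp (-T s/2) → exp (-s²/4)`, from `log (1 + u) = u - u²/2 + O(u³)`. -/
theorem tendsto_one_add_div_saddle_pow (s : ℝ) :
    Tendsto (fun n : ℕ => (1 + s / saddle n) ^ n * Real.exp (-(saddle n * s / 2))) atTop
      (𝓝 (Real.exp (-(s ^ 2 / 4)))) := by
  have hu : Tendsto (fun n : ℕ => s / saddle n) atTop (𝓝 0) :=
    tendsto_saddle.const_div_atTop s
  have hlim : Tendsto (fun n : ℕ => (n : ℝ) * Real.log (1 + s / saddle n) - saddle n * s / 2)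
      atTop (𝓝 (-(s ^ 2 / 4))) := by
    rw [tendsto_iff_norm_sub_tendsto_zero]
    have hb : Tendsto (fun n : ℕ => s ^ 2 / 2 * (|s / saddle n| / (1 - |s / saddle n|))) atTop
        (𝓝 0) := by
      have h := hu.abs
      rw [abs_zero] at h
      have := (h.div (h.const_sub 1) (by norm_num)).const_mul (s ^ 2 / 2)
      simpa using this
    refine squeeze_zero' (Eventually.of_forall fun _ => norm_nonneg _) ?_ hb
    filter_upwards [hu.eventually (Metric.ball_mem_nhds 0 one_pos), eventually_ge_atTop 1]
      with n h1 hn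
    have hT : 0 < saddle n := one_pos.trans_le (one_le_saddle hn)
    have hsq := saddle_sq n
    rw [Real.dist_0_eq_abs] at h1
    have habs : |-(s / saddle n)| < 1 := by
      rwa [abs_neg]
    have h := Real.abs_log_sub_add_sum_range_le habs 2
    simp only [Finset.sum_range_succ, Finset.sum_range_zero, sub_neg_eq_add, abs_neg] at h habs
    set u := s / saddle n with hu'
    have hs : s = u * saddle n := by rw [hu']; field_simp
    have e : (n : ℝ) * Real.log (1 + u) - saddle n * s / 2 - -(s ^ 2 / 4) =
        n * (0 + (-u) ^ (0 + 1) / ((0 : ℕ) + 1) + (-u) ^ (1 + 1) / ((1 : ℕ) + 1) +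
          Real.log (1 + u)) := by
      rw [hs]
      push_cast
      linear_combination (-u / 2 + u ^ 2 / 4) * hsq
    rw [Real.norm_eq_abs, e, abs_mul, Nat.abs_cast]
    refine (mul_le_mul_of_nonneg_left h (Nat.cast_nonneg n)).trans (le_of_eq ?_)
    have e2 : |u| ^ (2 + 1) = u ^ 2 * |u| := by rw [pow_succ, sq_abs]
    rw [e2, hs]
    have hn2 : (n : ℝ) = saddle n ^ 2 / 2 := by linarith
    rw [hn2]
    ring
  refine (Real.continuous_exp.continuousAt.tendsto.comp hlim).congr' ?_
  filter_upwards [hu.eventually (Metric.ball_mem_nhds 0 one_pos)] with n h1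
  rw [Real.dist_0_eq_abs, abs_lt] at h1
  have hpos : 0 < 1 + s / saddle n := by linarith [h1.1]
  rw [Function.comp_apply, sub_eq_add_neg, Real.exp_add, mul_comm (n : ℝ), Real.exp_mul,
    Real.exp_log hpos, Real.rpow_natCast]

/-- The saddle integral converges to the Fourier integral of a Gaussian. -/
theorem tendsto_saddleIntegral (z : ℂ) :
    Tendsto (fun n => saddleIntegral n 0 0 z) atTop
      (𝓝 (Real.sqrt (2 * Real.pi) * Complex.exp (-z ^ 2 / 2))) := by
  have hlimit : ∫ s : ℝ, Complex.exp (-(1 / 2) * (s : ℂ) ^ 2 + Complex.I * z * s + 0) =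
      Real.sqrt (2 * Real.pi) * Complex.exp (-z ^ 2 / 2) := by
    rw [integral_cexp_quadratic (by norm_num)]
    congr 1
    · have h3 : ((Real.pi : ℂ) / - -(1 / 2)) = ((2 * Real.pi : ℝ) : ℂ) := by push_cast; ring
      rw [h3, show (1 / 2 : ℂ) = ((1 / 2 : ℝ) : ℂ) by push_cast; rfl,
        ← Complex.ofReal_cpow (by positivity), ← Real.sqrt_eq_rpow]
    · congr 1
      rw [mul_pow, Complex.I_sq]
      ring
  rw [← hlimit]
  simp only [saddleIntegral, ← integral_indicator measurableSet_Ioi]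
  refine tendsto_integral_filter_of_dominated_convergence
    (fun s : ℝ => |s| ^ 0 * (Real.exp (((0 : ℕ) + |z.im|) * |s|) * Real.exp (-(1 / 4) * s ^ 2)))
    (Eventually.of_forall fun n => ((continuous_saddleIntegrand n 0 0 z).measurable.indicator
      measurableSet_Ioi).aestronglyMeasurable) ?_
    (integrable_abs_pow_mul_exp_abs_mul_exp_neg_sq (by norm_num) _ 0) ?_
  · filter_upwards [eventually_ge_atTop 1] with n hn
    refine ae_of_all _ fun s => ?_
    by_cases hs : s ∈ Set.Ioi (-saddle n)
    · rw [Set.indicator_of_mem hs]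
      exact norm_saddleIntegrand_le 0 hn (Nat.zero_le n) le_rfl hs
    · rw [Set.indicator_of_notMem hs, norm_zero]
      positivity
  · refine ae_of_all _ fun s => ?_
    have h1 := ((Complex.continuous_ofReal.tendsto _).comp
      (tendsto_one_add_div_saddle_pow s)).mul_const
      (Complex.exp (-(s : ℂ) ^ 2 / 4 + Complex.I * s * z))
    have e1 : ((Real.exp (-(s ^ 2 / 4)) : ℝ) : ℂ) *
        Complex.exp (-(s : ℂ) ^ 2 / 4 + Complex.I * s * z) =
        Complex.exp (-(1 / 2) * (s : ℂ) ^ 2 + Complex.I * z * s + 0) := by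
      rw [Complex.ofReal_exp, ← Complex.exp_add]
      congr 1
      push_cast
      ring
    rw [e1] at h1
    refine h1.congr' ?_
    have hev : ∀ᶠ n in atTop, -s < saddle n := tendsto_saddle.eventually_gt_atTop (-s)
    filter_upwards [hev] with n hs
    rw [Set.indicator_of_mem (Set.mem_Ioi.2 (by linarith)), saddleIntegrand, Function.comp_apply]
    push_cast
    rw [pow_zero, one_mul, Nat.sub_zero, mul_assoc, ← Complex.exp_add]
    congr 2
    ring

/-! ### Contour shift and the limit of the boundary integrals -/

/-- Shifting a contour from the real axis to the parallel line through `c i`, for a function that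
is holomorphic on the closed strip between the two lines and decays like `(Re z)⁻²` there. -/
theorem integral_eq_integral_add_mul_I {g : ℂ → ℂ} {c C : ℝ}
    (hg : ∀ z : ℂ, z.im ∈ Set.uIcc 0 c → DifferentiableAt ℂ g z)
    (hb : ∀ z : ℂ, z.im ∈ Set.uIcc 0 c → ‖g z‖ ≤ C * (1 + z.re ^ 2)⁻¹) :
    Integrable (fun x : ℝ => g x) ∧ Integrable (fun x : ℝ => g (x + c * Complex.I)) ∧
      ∫ x : ℝ, g x = ∫ x : ℝ, g (x + c * Complex.I) := by
  have hline : ∀ d : ℝ, d ∈ Set.uIcc 0 c →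
      Integrable (fun x : ℝ => g (x + d * Complex.I)) := by
    intro d hd
    refine (integrable_inv_one_add_sq.const_mul C).mono'
      (Continuous.aestronglyMeasurable ?_) (ae_of_all _ fun x => ?_)
    · refine continuous_iff_continuousAt.2 fun x => ?_
      have h1 : ContinuousAt g ((x : ℂ) + d * Complex.I) := (hg _ (by simpa using hd)).continuousAt
      exact h1.comp (f := fun x : ℝ => (x : ℂ) + d * Complex.I)
        (Continuous.continuousAt (by fun_prop))
    · simpa using hb (x + d * Complex.I) (by simpa using hd)
  have h0 : Integrable (fun x : ℝ => g x) := by simpa using hline 0 Set.left_mem_uIcc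
  have hc := hline c Set.right_mem_uIcc
  refine ⟨h0, hc, ?_⟩
  have hrect : ∀ T : ℝ, (∫ x : ℝ in -T..T, g x) - (∫ x : ℝ in -T..T, g (x + c * Complex.I)) =
      Complex.I * (∫ y : ℝ in (0 : ℝ)..c, g ((-T : ℝ) + y * Complex.I)) -
      Complex.I * (∫ y : ℝ in (0 : ℝ)..c, g (T + y * Complex.I)) := by
    intro T
    have h := Complex.integral_boundary_rect_eq_zero_of_differentiableOn g (-T : ℝ)
      (T + c * Complex.I) (fun z hz => by
        rw [Complex.mem_reProdIm] at hz
        exact (hg z (by simpa using hz.2)).differentiableWithinAt)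
    simp only [Complex.ofReal_re, Complex.ofReal_im, Complex.add_re, Complex.mul_re, Complex.I_re,
      Complex.I_im, Complex.add_im, Complex.mul_im, smul_eq_mul, mul_zero, zero_mul, mul_one,
      sub_zero, add_zero, zero_add, Complex.ofReal_zero] at h
    linear_combination h
  have hside : ∀ T : ℝ, ‖∫ y : ℝ in (0 : ℝ)..c, g (T + y * Complex.I)‖ ≤
      C * (1 + T ^ 2)⁻¹ * |c| := by
    intro T
    have h := intervalIntegral.norm_integral_le_of_norm_le_const (a := 0) (b := c)
      (f := fun y : ℝ => g (T + y * Complex.I)) (C := C * (1 + T ^ 2)⁻¹) fun y hy => by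
        have := hb (T + y * Complex.I) (by simpa using Set.uIoc_subset_uIcc hy)
        simpa using this
    simpa using h
  have hlim1 := (intervalIntegral_tendsto_integral h0 tendsto_neg_atTop_atBot tendsto_id).sub
    (intervalIntegral_tendsto_integral hc tendsto_neg_atTop_atBot tendsto_id)
  have hlim2 : Tendsto (fun T : ℝ => (∫ x : ℝ in -T..id T, g x) -
      (∫ x : ℝ in -T..id T, g (x + c * Complex.I))) atTop (𝓝 0) := by
    have hz : Tendsto (fun T : ℝ => 2 * (C * (1 + T ^ 2)⁻¹ * |c|)) atTop (𝓝 0) := by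
      have h1 : Tendsto (fun T : ℝ => (1 + T ^ 2)⁻¹) atTop (𝓝 0) :=
        (tendsto_atTop_add_const_left _ _ (tendsto_pow_atTop two_ne_zero)).inv_tendsto_atTop
      simpa using ((h1.const_mul C).mul_const |c|).const_mul 2
    refine squeeze_zero_norm (fun T => ?_) hz
    rw [id, hrect T]
    refine (norm_sub_le _ _).trans ?_
    rw [norm_mul, norm_mul, Complex.norm_I, one_mul, one_mul]
    have h1 := hside (-T)
    have h2 := hside T
    rw [neg_sq] at h1
    linarith
  exact sub_eq_zero.1 (tendsto_nhds_unique hlim1 hlim2)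

/-- A function that is continuous on the strip and `O(|z|^σ)` at infinity is bounded there by a
multiple of `(1 + |z|)^m` for some natural number `m`. -/
theorem exists_norm_le_of_isBigO {ρ σ : ℝ} {f : ℂ → ℂ} (hf : ContinuousOn f (closedStrip ρ))
    (hgrowth : f =O[Bornology.cobounded ℂ ⊓ 𝓟 (closedStrip ρ)] fun z : ℂ => ‖z‖ ^ σ) :
    ∃ (C : ℝ) (m : ℕ), 0 ≤ C ∧ ∀ z ∈ closedStrip ρ, ‖f z‖ ≤ C * (1 + ‖z‖) ^ m := by
  obtain ⟨c, hc0, hc⟩ := hgrowth.exists_nonneg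
  have hev := hc.bound
  rw [eventually_inf_principal, (hasBasis_cobounded_norm (E := ℂ)).eventually_iff] at hev
  obtain ⟨R, -, hR⟩ := hev
  have hclosed : IsClosed (closedStrip ρ) := isClosed_Icc.preimage Complex.continuous_im
  obtain ⟨B, hB⟩ := ((isCompact_closedBall (0 : ℂ) (max R 1)).inter_right
    hclosed).exists_bound_of_continuousOn (hf.mono Set.inter_subset_right)
  refine ⟨max B c, ⌈|σ|⌉₊, hc0.trans (le_max_right _ _), fun z hz => ?_⟩
  have h1 : 1 ≤ (1 + ‖z‖) ^ ⌈|σ|⌉₊ := one_le_pow₀ (by linarith [norm_nonneg z])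
  have hnn : 0 ≤ max B c := hc0.trans (le_max_right _ _)
  rcases le_or_gt ‖z‖ (max R 1) with h | h
  · calc ‖f z‖ ≤ B := hB z ⟨by simpa using h, hz⟩
      _ ≤ max B c * 1 := by rw [mul_one]; exact le_max_left _ _
      _ ≤ _ := by gcongr
  · have hRz : R ≤ ‖z‖ := (le_max_left _ _).trans h.le
    have h1z : 1 ≤ ‖z‖ := (le_max_right _ _).trans h.le
    calc ‖f z‖ ≤ c * ‖‖z‖ ^ σ‖ := hR hRz hz
      _ = c * ‖z‖ ^ σ := by rw [Real.norm_of_nonneg (by positivity)]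
      _ ≤ max B c * ‖z‖ ^ ((⌈|σ|⌉₊ : ℕ) : ℝ) := by
        gcongr
        · exact le_max_right _ _
        · exact (le_abs_self σ).trans (Nat.le_ceil _)
      _ ≤ max B c * (1 + ‖z‖) ^ ⌈|σ|⌉₊ := by
        rw [Real.rpow_natCast]
        gcongr
        linarith

theorem memL2Weight_of_norm_le {g : ℝ → ℂ} (hg : Continuous g) {C : ℝ} {m : ℕ}
    (hb : ∀ x, ‖g x‖ ≤ C * (1 + |x|) ^ m) : MemL2Weight g := by
  refine ⟨hg.aestronglyMeasurable, ?_⟩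
  have hI := (integrable_abs_pow_mul_exp_abs_mul_exp_neg_sq one_pos (2 * m) 0).const_mul (C ^ 2)
  refine hI.mono' (Continuous.aestronglyMeasurable (by unfold hermiteWeight; fun_prop))
    (ae_of_all _ fun x => ?_)
  rw [Real.norm_of_nonneg (mul_nonneg (sq_nonneg _) (hermiteWeight_pos x).le), pow_zero, one_mul,
    ← mul_assoc]
  have h1 : ‖g x‖ ^ 2 ≤ C ^ 2 * Real.exp (2 * m * |x|) := by
    calc ‖g x‖ ^ 2 ≤ (C * (1 + |x|) ^ m) ^ 2 := by gcongr; exact hb x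
      _ = C ^ 2 * ((1 + |x|) ^ m) ^ 2 := by ring
      _ ≤ C ^ 2 * (Real.exp |x| ^ m) ^ 2 := by
        gcongr
        rw [add_comm]; exact Real.add_one_le_exp _
      _ = C ^ 2 * Real.exp (2 * m * |x|) := by
        rw [← Real.exp_nat_mul, ← Real.exp_nat_mul]
        congr 2
        push_cast
        ring
  have h2 : hermiteWeight x = Real.exp (-1 * x ^ 2) := by rw [hermiteWeight]; congr 1; ring
  rw [h2]
  gcongr

/-- The product of `f` with a saddle integral decays like `(Re z)⁻²`, uniformly in the degree. -/
theorem exists_norm_saddleIntegral_mul_le {ρ : ℝ} {f : ℂ → ℂ} {C : ℝ} {m : ℕ} (hC : 0 ≤ C)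
    (hb : ∀ z ∈ closedStrip ρ, ‖f z‖ ≤ C * (1 + ‖z‖) ^ m) :
    ∃ B : ℝ, 0 ≤ B ∧ ∀ n, m + 3 ≤ n → ∀ z ∈ closedStrip ρ, ∀ w : ℂ, ‖w‖ = ‖z‖ → |w.im| ≤ ρ →
      ‖saddleIntegral n 0 0 w * f z‖ ≤ B * (1 + z.re ^ 2)⁻¹ := by
  obtain ⟨C0, h0⟩ := exists_pow_mul_norm_saddleIntegral_le ρ 0 0 0
  obtain ⟨C1, h1⟩ := exists_pow_mul_norm_saddleIntegral_le ρ (m + 2) 0 0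
  refine ⟨|C * (2 ^ (m + 1) * (C0 + C1))|, abs_nonneg _, fun n hn z hz w hwz hw => ?_⟩
  have e0 := h0 n (by omega) w hw
  have e1 := h1 n (by omega) w hw
  rw [pow_zero, one_mul] at e0
  set S := ‖saddleIntegral n 0 0 w‖ with hS
  have hS0 : 0 ≤ S := norm_nonneg _
  have hz0 := norm_nonneg z
  -- the exponent `m` compensates the growth of `f`, the remaining `2` gives integrability
  have e2 : (1 + ‖z‖) ^ (m + 2) * S ≤ 2 ^ (m + 1) * (C0 + C1) := by
    have h := add_pow_le zero_le_one hz0 (m + 2)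
    rw [one_pow] at h
    calc (1 + ‖z‖) ^ (m + 2) * S ≤ 2 ^ (m + 1) * (1 + ‖z‖ ^ (m + 2)) * S := by
          gcongr; exact h
      _ = 2 ^ (m + 1) * (S + ‖w‖ ^ (m + 2) * S) := by rw [hwz]; ring
      _ ≤ _ := by gcongr
  have hre : 1 + z.re ^ 2 ≤ (1 + ‖z‖) ^ 2 := by
    have := Complex.abs_re_le_norm z
    have h2 : z.re ^ 2 ≤ ‖z‖ ^ 2 := by rw [← sq_abs]; gcongr
    nlinarith
  rw [norm_mul, ← div_eq_mul_inv, le_div_iff₀ (by positivity)]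
  calc S * ‖f z‖ * (1 + z.re ^ 2) ≤ S * (C * (1 + ‖z‖) ^ m) * (1 + ‖z‖) ^ 2 := by
        gcongr; exact hb z hz
    _ = C * ((1 + ‖z‖) ^ (m + 2) * S) := by ring
    _ ≤ C * (2 ^ (m + 1) * (C0 + C1)) := by gcongr
    _ ≤ _ := le_abs_self _

/-- The integral `∫ |F_n(± z) f(z)| |dz|` over the boundary of the strip, with the sign `+` on the
upper and `-` on the lower line; `F_n` is the saddle integral. -/
noncomputable def saddleBoundaryIntegral (ρ : ℝ) (f : ℂ → ℂ) (n : ℕ) : ℝ :=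
  (∫ x : ℝ, ‖saddleIntegral n 0 0 (x + ρ * Complex.I) * f (x + ρ * Complex.I)‖) +
    ∫ x : ℝ, ‖saddleIntegral n 0 0 (-(x - ρ * Complex.I)) * f (x - ρ * Complex.I)‖

theorem norm_gaussHalf {n : ℕ} (hn : 1 ≤ n) (z : ℂ) :
    ‖gaussHalf n z‖ = saddle n ^ n * Real.exp (-(saddle n ^ 2 / 4)) *
      Real.exp (-(saddle n * z.im)) * ‖saddleIntegral n 0 0 z‖ := by
  have hT : 0 ≤ saddle n := Real.sqrt_nonneg _
  rw [gaussHalf_eq_saddleIntegral hn, norm_mul, norm_mul, Complex.norm_real,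
    Real.norm_of_nonneg (by positivity), Complex.norm_exp]
  congr 3
  simp [Complex.mul_re]

theorem norm_hermiteCoeff_mul_eq (g : ℝ → ℂ) (n : ℕ) :
    ‖hermiteCoeff g n‖ * (2 * Real.sqrt Real.pi * hermiteGamma n) =
      ‖∫ x : ℝ, g x * (Complex.I ^ n * gaussHalf n x + (-Complex.I) ^ n * gaussHalf n (-x))‖ := by
  simp_rw [← iteratedDeriv_hermiteWeight_eq_gaussHalf]
  have hγ := hermiteGamma_pos n
  have e : ∀ x : ℝ, g x * (2 * Real.sqrt Real.pi * ((iteratedDeriv n hermiteWeight x : ℝ) : ℂ)) =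
      (2 * Real.sqrt Real.pi * (-1) ^ n) *
        (g x * (hermiteH n x : ℂ) * (hermiteWeight x : ℂ)) := by
    intro x
    rw [iteratedDeriv_hermiteWeight, hermiteH_eq_eval]
    push_cast
    ring
  simp_rw [e]
  rw [integral_const_mul, hermiteCoeff, norm_div, norm_mul, norm_mul, norm_mul, norm_pow, norm_neg,
    norm_one, one_pow, Complex.norm_real, Complex.norm_real, Real.norm_of_nonneg hγ.le,
    Real.norm_of_nonneg (Real.sqrt_nonneg _), RCLike.norm_ofNat]
  field_simp

/-- The two halves of the Fourier representation are integrated over the upper and the lower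
boundary line respectively, where each carries the factor `exp (-ρ √(2n))`. -/
theorem norm_hermiteCoeff_mul_le {ρ : ℝ} (hρ : 0 < ρ) {f : ℂ → ℂ}
    (hf : AnalyticOnNhd ℂ f (closedStrip ρ)) {C : ℝ} {m : ℕ} (hC : 0 ≤ C)
    (hb : ∀ z ∈ closedStrip ρ, ‖f z‖ ≤ C * (1 + ‖z‖) ^ m) {n : ℕ} (hn : m + 3 ≤ n) :
    ‖hermiteCoeff (fun x : ℝ => f x) n‖ * (2 * Real.sqrt Real.pi * hermiteGamma n) ≤
      saddle n ^ n * Real.exp (-(saddle n ^ 2 / 4)) * Real.exp (-(saddle n * ρ)) *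
        saddleBoundaryIntegral ρ f n := by
  have hn1 : 1 ≤ n := by omega
  have hT : 0 ≤ saddle n := Real.sqrt_nonneg _
  set D := saddle n ^ n * Real.exp (-(saddle n ^ 2 / 4)) with hD
  have hD0 : 0 ≤ D := by positivity
  obtain ⟨B, hB0, hB⟩ := exists_norm_saddleIntegral_mul_le hC hb
  have hup : ∀ {y : ℝ}, y ∈ Set.uIcc 0 ρ → 0 ≤ y ∧ y ≤ ρ := fun {y} hy => by
    rwa [Set.uIcc_of_le hρ.le] at hy
  have hlo : ∀ {y : ℝ}, y ∈ Set.uIcc 0 (-ρ) → -ρ ≤ y ∧ y ≤ 0 := fun {y} hy => by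
    rwa [Set.uIcc_of_ge (by linarith)] at hy
  have hG : ∀ z, DifferentiableAt ℂ (gaussHalf n) z := fun z =>
    (hasDerivAt_gaussHalf n z).differentiableAt
  obtain ⟨i1, -, s1⟩ := integral_eq_integral_add_mul_I (g := fun z => f z * gaussHalf n z)
    (c := ρ) (C := D * B) (fun z hz => by
      obtain ⟨h1, h2⟩ := hup hz
      exact (hf z ⟨by linarith, h2⟩).differentiableAt.mul (hG z)) (fun z hz => by
      obtain ⟨h1, h2⟩ := hup hz
      have h3 := hB n hn z ⟨by linarith, h2⟩ z rfl (by rw [abs_of_nonneg h1]; exact h2)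
      rw [norm_mul] at h3
      have h4 : Real.exp (-(saddle n * z.im)) ≤ 1 :=
        Real.exp_le_one_iff.2 (neg_nonpos.2 (mul_nonneg hT h1))
      rw [norm_mul, norm_gaussHalf hn1]
      calc ‖f z‖ * (D * Real.exp (-(saddle n * z.im)) * ‖saddleIntegral n 0 0 z‖)
          = D * Real.exp (-(saddle n * z.im)) * (‖saddleIntegral n 0 0 z‖ * ‖f z‖) := by ring
        _ ≤ D * 1 * (B * (1 + z.re ^ 2)⁻¹) := by gcongr
        _ = _ := by ring)
  obtain ⟨i2, -, s2⟩ := integral_eq_integral_add_mul_I (g := fun z => f z * gaussHalf n (-z))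
    (c := -ρ) (C := D * B) (fun z hz => by
      obtain ⟨h1, h2⟩ := hlo hz
      exact (hf z ⟨h1, by linarith⟩).differentiableAt.mul
        ((hG (-z)).comp z differentiableAt_id.neg)) (fun z hz => by
      obtain ⟨h1, h2⟩ := hlo hz
      have h3 := hB n hn z ⟨h1, by linarith⟩ (-z) (norm_neg z)
        (by rw [Complex.neg_im, abs_neg, abs_of_nonpos h2]; linarith)
      rw [norm_mul] at h3
      have h4 : Real.exp (-(saddle n * (-z).im)) ≤ 1 :=
        Real.exp_le_one_iff.2 (neg_nonpos.2 (mul_nonneg hT (by rw [Complex.neg_im]; linarith)))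
      rw [norm_mul, norm_gaussHalf hn1]
      calc ‖f z‖ * (D * Real.exp (-(saddle n * (-z).im)) * ‖saddleIntegral n 0 0 (-z)‖)
          = D * Real.exp (-(saddle n * (-z).im)) * (‖saddleIntegral n 0 0 (-z)‖ * ‖f z‖) := by ring
        _ ≤ D * 1 * (B * (1 + z.re ^ 2)⁻¹) := by gcongr
        _ = _ := by ring)
  rw [norm_hermiteCoeff_mul_eq]
  have e : ∀ x : ℝ, f x * (Complex.I ^ n * gaussHalf n x + (-Complex.I) ^ n * gaussHalf n (-x)) =
      Complex.I ^ n * (f x * gaussHalf n x) + (-Complex.I) ^ n * (f x * gaussHalf n (-x)) := by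
    intro x; ring
  simp_rw [e]
  rw [integral_add (i1.const_mul _) (i2.const_mul _), integral_const_mul, integral_const_mul, s1,
    s2]
  refine (norm_add_le _ _).trans ?_
  rw [norm_mul, norm_mul, norm_pow, norm_pow, norm_neg, Complex.norm_I, one_pow, one_mul, one_mul,
    saddleBoundaryIntegral, mul_add, ← integral_const_mul, ← integral_const_mul]
  refine add_le_add ((norm_integral_le_integral_norm _).trans (le_of_eq ?_))
    ((norm_integral_le_integral_norm _).trans (le_of_eq ?_))
  · congr 1
    ext x
    rw [norm_mul, norm_mul, norm_gaussHalf hn1]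
    have : ((x : ℂ) + ρ * Complex.I).im = ρ := by simp
    rw [this]
    ring
  · congr 1
    ext x
    have e1 : (x : ℂ) + ((-ρ : ℝ) : ℂ) * Complex.I = x - ρ * Complex.I := by push_cast; ring
    rw [e1, norm_mul, norm_mul, norm_gaussHalf hn1]
    have : (-((x : ℂ) - ρ * Complex.I)).im = ρ := by simp
    rw [this]
    ring

/-- Convergence of one of the two line integrals in `saddleBoundaryIntegral`, by dominated
convergence; the dominating function also bounds the limit, which gives its integrability. -/
theorem tendsto_integral_norm_saddleIntegral_mul {ρ : ℝ} {f : ℂ → ℂ}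
    (hf : ContinuousOn f (closedStrip ρ)) {C : ℝ} {m : ℕ} (hC : 0 ≤ C)
    (hb : ∀ z ∈ closedStrip ρ, ‖f z‖ ≤ C * (1 + ‖z‖) ^ m) {ζ ξ : ℝ → ℂ} (hζ : Continuous ζ)
    (hmem : ∀ x, ζ x ∈ closedStrip ρ) (hre : ∀ x, (ζ x).re = x) (hξ : Continuous ξ)
    (hsq : ∀ x, ξ x ^ 2 = ζ x ^ 2) (him : ∀ x, |(ξ x).im| ≤ ρ) :
    Integrable (fun x => gaussAbs f (ζ x)) ∧
      Tendsto (fun n => ∫ x, ‖saddleIntegral n 0 0 (ξ x) * f (ζ x)‖) atTop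
        (𝓝 (Real.sqrt (2 * Real.pi) * ∫ x, gaussAbs f (ζ x))) := by
  obtain ⟨B, hB0, hB⟩ := exists_norm_saddleIntegral_mul_le hC hb
  have hfζ : Continuous fun x => f (ζ x) := hf.comp_continuous hζ hmem
  have hnorm : ∀ x, ‖ξ x‖ = ‖ζ x‖ := fun x => by
    have := congrArg norm (hsq x)
    rw [norm_pow, norm_pow] at this
    exact (pow_left_inj₀ (norm_nonneg _) (norm_nonneg _) two_ne_zero).1 this
  have hbd : ∀ n, m + 3 ≤ n → ∀ x, ‖saddleIntegral n 0 0 (ξ x) * f (ζ x)‖ ≤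
      B * (1 + x ^ 2)⁻¹ := fun n hn x => by
    have := hB n hn (ζ x) (hmem x) (ξ x) (hnorm x) (him x)
    rwa [hre] at this
  have hpt : ∀ x, Tendsto (fun n => ‖saddleIntegral n 0 0 (ξ x) * f (ζ x)‖) atTop
      (𝓝 (Real.sqrt (2 * Real.pi) * gaussAbs f (ζ x))) := fun x => by
    have h := ((tendsto_saddleIntegral (ξ x)).mul_const (f (ζ x))).norm
    have e : ‖Real.sqrt (2 * Real.pi) * Complex.exp (-ξ x ^ 2 / 2) * f (ζ x)‖ =
        Real.sqrt (2 * Real.pi) * gaussAbs f (ζ x) := by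
      rw [gaussAbs, hsq, mul_assoc, norm_mul, Complex.norm_real,
        Real.norm_of_nonneg (Real.sqrt_nonneg _)]
    rwa [e] at h
  -- continuity in `z` is inherited from the entire function `gaussHalf n`
  have hcont : ∀ n, 1 ≤ n → Continuous (saddleIntegral n 0 0) := fun n hn => by
    have hT : 0 < saddle n := one_pos.trans_le (one_le_saddle hn)
    have hA : ((saddle n ^ n * Real.exp (-(saddle n ^ 2 / 4)) : ℝ) : ℂ) ≠ 0 := by
      exact_mod_cast (by positivity : 0 < saddle n ^ n * Real.exp (-(saddle n ^ 2 / 4))).ne'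
    have : saddleIntegral n 0 0 = fun z => gaussHalf n z /
        (((saddle n ^ n * Real.exp (-(saddle n ^ 2 / 4)) : ℝ) : ℂ) *
          Complex.exp (Complex.I * saddle n * z)) := by
      ext z
      rw [gaussHalf_eq_saddleIntegral hn, mul_div_cancel_left₀]
      exact mul_ne_zero hA (Complex.exp_ne_zero _)
    rw [this]
    exact (continuous_gaussHalf n).div (by fun_prop) fun z =>
      mul_ne_zero hA (Complex.exp_ne_zero _)
  have hdom : Integrable fun x : ℝ => B * (1 + x ^ 2)⁻¹ := integrable_inv_one_add_sq.const_mul B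
  constructor
  · have hI : Integrable fun x => Real.sqrt (2 * Real.pi) * gaussAbs f (ζ x) := by
      have hcexp : Continuous fun x => Complex.exp (-ζ x ^ 2 / 2) := by fun_prop
      refine hdom.mono' ((hcexp.mul hfζ).norm.const_mul _).aestronglyMeasurable
        (ae_of_all _ fun x => ?_)
      have hnn : 0 ≤ gaussAbs f (ζ x) := norm_nonneg _
      rw [Real.norm_of_nonneg (mul_nonneg (Real.sqrt_nonneg _) hnn)]
      exact le_of_tendsto (hpt x) (eventually_atTop.2 ⟨m + 3, fun n hn => hbd n hn x⟩)
    have := hI.const_mul (Real.sqrt (2 * Real.pi))⁻¹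
    refine this.congr (ae_of_all _ fun x => ?_)
    have hpos : 0 < Real.sqrt (2 * Real.pi) := by positivity
    simp only []
    field_simp
  · rw [← integral_const_mul]
    refine tendsto_integral_filter_of_dominated_convergence _ ?_ ?_ hdom (ae_of_all _ hpt)
    · filter_upwards [eventually_ge_atTop 1] with n hn
      exact (((hcont n hn).comp hξ).mul hfζ).norm.aestronglyMeasurable
    · filter_upwards [eventually_ge_atTop (m + 3)] with n hn
      refine ae_of_all _ fun x => ?_
      rw [norm_norm]
      exact hbd n hn x

theorem tendsto_saddleBoundaryIntegral {ρ : ℝ} (hρ : 0 < ρ) {f : ℂ → ℂ}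
    (hf : ContinuousOn f (closedStrip ρ)) {C : ℝ} {m : ℕ} (hC : 0 ≤ C)
    (hb : ∀ z ∈ closedStrip ρ, ‖f z‖ ≤ C * (1 + ‖z‖) ^ m) :
    StripBoundaryIntegrable ρ (gaussAbs f) ∧
      Tendsto (saddleBoundaryIntegral ρ f) atTop (𝓝 (Real.sqrt (2 * Real.pi) * stripV ρ f)) := by
  have h1 := tendsto_integral_norm_saddleIntegral_mul hf hC hb
    (ζ := fun x : ℝ => x + ρ * Complex.I) (ξ := fun x : ℝ => x + ρ * Complex.I) (by fun_prop)
    (fun x => by simp [closedStrip, hρ.le]) (fun x => by simp) (by fun_prop) (fun x => rfl)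
    (fun x => by simp [abs_of_pos hρ])
  have h2 := tendsto_integral_norm_saddleIntegral_mul hf hC hb
    (ζ := fun x : ℝ => x - ρ * Complex.I) (ξ := fun x : ℝ => -(x - ρ * Complex.I)) (by fun_prop)
    (fun x => by simp [closedStrip, hρ.le]) (fun x => by simp) (by fun_prop) (fun x => neg_sq _)
    (fun x => by simp [abs_of_pos hρ])
  refine ⟨⟨h1.1, h2.1⟩, ?_⟩
  rw [stripV, stripBoundaryIntegral, mul_add]
  exact h1.2.add h2.2

/-! ### Coefficient bound and projection error -/

/-- Log-convexity of `Γ` between `x` and `x + 1`. -/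
theorem Gamma_add_half_le {x : ℝ} (hx : 0 < x) :
    Real.Gamma (x + 1 / 2) ≤ Real.sqrt x * Real.Gamma x := by
  have h := Real.Gamma_mul_add_mul_le_rpow_Gamma_mul_rpow_Gamma hx (by linarith : 0 < x + 1)
    (by norm_num : (0 : ℝ) < 1 / 2) (by norm_num : (0 : ℝ) < 1 / 2) (by norm_num)
  have hG := Real.Gamma_pos_of_pos hx
  rw [show 1 / 2 * x + 1 / 2 * (x + 1) = x + 1 / 2 by ring, Real.Gamma_add_one hx.ne',
    ← Real.sqrt_eq_rpow, ← Real.sqrt_eq_rpow, Real.sqrt_mul hx.le] at h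
  calc _ ≤ _ := h
    _ = Real.sqrt x * (Real.sqrt (Real.Gamma x) * Real.sqrt (Real.Gamma x)) := by ring
    _ = _ := by rw [Real.mul_self_sqrt hG.le]

theorem tendsto_sqrt_mul_Gamma_div_Gamma_add_half :
    Tendsto (fun x : ℝ => Real.sqrt x * Real.Gamma x / Real.Gamma (x + 1 / 2)) atTop (𝓝 1) := by
  have hup : Tendsto (fun x : ℝ => Real.sqrt (1 + 1 / 2 * x⁻¹)) atTop (𝓝 1) := by
    have h : Tendsto (fun x : ℝ => 1 + 1 / 2 * x⁻¹) atTop (𝓝 (1 + 1 / 2 * 0)) :=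
      (tendsto_inv_atTop_zero.const_mul _).const_add _
    simpa using h.sqrt
  refine tendsto_of_tendsto_of_tendsto_of_le_of_le' tendsto_const_nhds hup ?_ ?_
  · filter_upwards [eventually_gt_atTop 0] with x hx
    rw [one_le_div (Real.Gamma_pos_of_pos (by linarith))]
    exact Gamma_add_half_le hx
  · filter_upwards [eventually_gt_atTop 0] with x hx
    rw [div_le_iff₀ (Real.Gamma_pos_of_pos (by linarith))]
    have h := Gamma_add_half_le (by linarith : 0 < x + 1 / 2)
    rw [show x + 1 / 2 + 1 / 2 = x + 1 by ring, Real.Gamma_add_one hx.ne'] at h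
    have hs := Real.sqrt_pos.2 hx
    have e : x + 1 / 2 = x * (1 + 1 / 2 * x⁻¹) := by field_simp
    rw [e, Real.sqrt_mul hx.le, ← e] at h
    refine le_of_mul_le_mul_left ?_ hs
    calc Real.sqrt x * (Real.sqrt x * Real.Gamma x) = x * Real.Gamma x := by
          rw [← mul_assoc, Real.mul_self_sqrt hx.le]
      _ ≤ _ := h
      _ = _ := by ring

/-- Legendre's duplication formula, applied to `n! = Γ(n + 1)`. -/
theorem hermiteGamma_eq (n : ℕ) :
    hermiteGamma n =
      2 ^ n * (2 ^ n *
        (Real.Gamma (((n : ℝ) + 1) / 2) * Real.Gamma (((n : ℝ) + 1) / 2 + 1 / 2))) := by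
  rw [Real.Gamma_mul_Gamma_add_half, hermiteGamma, show 2 * (((n : ℝ) + 1) / 2) = n + 1 by ring,
    Real.Gamma_nat_eq_factorial, show (1 : ℝ) - (n + 1) = -n by ring, Real.rpow_neg (by norm_num),
    Real.rpow_natCast]
  field_simp

/-- `2ⁿ Γ((n+1)/2) = ∫_0^∞ tⁿ exp (-t²/4) dt` in terms of the saddle integral at `0`. -/
theorem saddle_pow_mul_norm_saddleIntegral_zero {n : ℕ} (hn : 1 ≤ n) :
    saddle n ^ n * Real.exp (-(saddle n ^ 2 / 4)) * ‖saddleIntegral n 0 0 0‖ =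
      2 ^ n * Real.Gamma (((n : ℝ) + 1) / 2) := by
  have h := norm_gaussHalf hn 0
  have hG : 0 < Real.Gamma (((n : ℝ) + 1) / 2) := Real.Gamma_pos_of_pos (by positivity)
  rw [gaussHalf_apply_zero, Complex.norm_real, Real.norm_of_nonneg (by positivity)] at h
  simpa using h.symm

/-- The boundary integral of `saddleBoundaryIntegral`, normalized so that it tends to `V`. -/
noncomputable def saddleRatio (ρ : ℝ) (f : ℂ → ℂ) (n : ℕ) : ℝ :=
  saddleBoundaryIntegral ρ f n / ‖saddleIntegral n 0 0 0‖

theorem tendsto_saddleRatio {ρ : ℝ} {f : ℂ → ℂ}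
    (h : Tendsto (saddleBoundaryIntegral ρ f) atTop (𝓝 (Real.sqrt (2 * Real.pi) * stripV ρ f))) :
    Tendsto (saddleRatio ρ f) atTop (𝓝 (stripV ρ f)) := by
  have hpos : 0 < Real.sqrt (2 * Real.pi) := by positivity
  have h0 : Tendsto (fun n => ‖saddleIntegral n 0 0 0‖) atTop (𝓝 (Real.sqrt (2 * Real.pi))) := by
    have := (tendsto_saddleIntegral 0).norm
    simpa [abs_of_nonneg (Real.sqrt_nonneg _)] using this
  have := h.div h0 hpos.ne'
  rwa [mul_div_cancel_left₀ _ hpos.ne'] at this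

theorem saddleRatio_nonneg (ρ : ℝ) (f : ℂ → ℂ) (n : ℕ) : 0 ≤ saddleRatio ρ f n :=
  div_nonneg (add_nonneg (integral_nonneg fun _ => norm_nonneg _)
    (integral_nonneg fun _ => norm_nonneg _)) (norm_nonneg _)

/-- The coefficient bound with its exact prefactor, before the asymptotics of `Γ` are used. -/
theorem norm_hermiteCoeff_mul_Gamma_le {ρ : ℝ} (hρ : 0 < ρ) {f : ℂ → ℂ}
    (hf : AnalyticOnNhd ℂ f (closedStrip ρ)) {C : ℝ} {m : ℕ} (hC : 0 ≤ C)
    (hb : ∀ z ∈ closedStrip ρ, ‖f z‖ ≤ C * (1 + ‖z‖) ^ m) {n : ℕ} (hn : m + 3 ≤ n) :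
    ‖hermiteCoeff (fun x : ℝ => f x) n‖ *
        (2 * Real.sqrt Real.pi * (2 ^ n * Real.Gamma (((n : ℝ) + 1) / 2 + 1 / 2))) ≤
      Real.exp (-(saddle n * ρ)) * saddleRatio ρ f n := by
  have h := norm_hermiteCoeff_mul_le hρ hf hC hb hn
  have h0 := saddle_pow_mul_norm_saddleIntegral_zero (n := n) (by omega)
  have hG : 0 < Real.Gamma (((n : ℝ) + 1) / 2) := Real.Gamma_pos_of_pos (by positivity)
  have hA : 0 < 2 ^ n * Real.Gamma (((n : ℝ) + 1) / 2) := by positivity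
  have hφ : ‖saddleIntegral n 0 0 0‖ ≠ 0 := by
    intro h1
    rw [h1, mul_zero] at h0
    exact hA.ne h0
  refine le_of_mul_le_mul_right ?_ hA
  rw [hermiteGamma_eq] at h
  calc _ = ‖hermiteCoeff (fun x : ℝ => f x) n‖ * (2 * Real.sqrt Real.pi * (2 ^ n * (2 ^ n *
        (Real.Gamma (((n : ℝ) + 1) / 2) * Real.Gamma (((n : ℝ) + 1) / 2 + 1 / 2))))) := by ring
    _ ≤ _ := h
    _ = _ := by
      rw [← h0, saddleRatio]
      field_simp

/-- An asymptotic upper bound is realized by the convergent sequence `max L (x n)`. -/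
theorem exists_tendsto_of_eventually_le {x : ℕ → ℝ} {L : ℝ}
    (h : ∀ δ > 0, ∀ᶠ n in atTop, x n ≤ L + δ) :
    ∃ K : ℕ → ℝ, Tendsto K atTop (𝓝 L) ∧ ∀ n, x n ≤ K n := by
  refine ⟨fun n => max L (x n), ?_, fun n => le_max_right _ _⟩
  refine tendsto_order.2 ⟨fun a ha => Eventually.of_forall fun n => ha.trans_le (le_max_left _ _),
    fun a ha => ?_⟩
  filter_upwards [h ((a - L) / 2) (by linarith)] with n hn
  exact max_lt ha (by linarith)

theorem tendsto_saddle_succ_sub : Tendsto (fun n => saddle (n + 1) - saddle n) atTop (𝓝 0) := by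
  refine squeeze_zero' (Eventually.of_forall fun n => ?_) ?_
    ((tendsto_saddle.const_div_atTop 2))
  · exact sub_nonneg.2 (Real.sqrt_le_sqrt (by push_cast; linarith))
  · filter_upwards [eventually_ge_atTop 1] with n hn
    have hT : 0 < saddle n := one_pos.trans_le (one_le_saddle hn)
    have hT' : 0 ≤ saddle (n + 1) := Real.sqrt_nonneg _
    have h1 := saddle_sq n
    have h2 := saddle_sq (n + 1)
    push_cast at h2
    rw [le_div_iff₀ hT]
    have h3 : saddle n ≤ saddle (n + 1) := Real.sqrt_le_sqrt (by push_cast; linarith)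
    nlinarith

/-- `√((n+1)/2) Γ((n+1)/2) / Γ(n/2+1)`, which tends to `1`. -/
noncomputable def gammaRatio (n : ℕ) : ℝ :=
  Real.sqrt (((n : ℝ) + 1) / 2) * Real.Gamma (((n : ℝ) + 1) / 2) /
    Real.Gamma (((n : ℝ) + 1) / 2 + 1 / 2)

theorem tendsto_gammaRatio : Tendsto gammaRatio atTop (𝓝 1) := by
  refine tendsto_sqrt_mul_Gamma_div_Gamma_add_half.comp
    (Tendsto.atTop_div_const two_pos ?_)
  exact tendsto_atTop_add_const_right _ _ tendsto_natCast_atTop_atTop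

theorem gammaRatio_nonneg (n : ℕ) : 0 ≤ gammaRatio n := by
  have h1 : 0 < Real.Gamma (((n : ℝ) + 1) / 2) := Real.Gamma_pos_of_pos (by positivity)
  have h2 : 0 < Real.Gamma (((n : ℝ) + 1) / 2 + 1 / 2) := Real.Gamma_pos_of_pos (by positivity)
  unfold gammaRatio
  positivity

theorem exists_hermiteCoeff_bound {ρ : ℝ} (hρ : 0 < ρ) {f : ℂ → ℂ}
    (hf : AnalyticOnNhd ℂ f (closedStrip ρ)) {C : ℝ} {m : ℕ} (hC : 0 ≤ C)
    (hb : ∀ z ∈ closedStrip ρ, ‖f z‖ ≤ C * (1 + ‖z‖) ^ m) :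
    ∃ K : ℕ → ℝ, Tendsto K atTop (𝓝 (stripV ρ f)) ∧
      ∀ n : ℕ, ‖hermiteCoeff (fun x : ℝ => f (x : ℂ)) n‖ ≤
        K n * Real.exp (-ρ * Real.sqrt (2 * ((n : ℝ) + 1))) /
          (2 ^ n * Real.sqrt (2 * Real.pi * ((n : ℝ) + 1)) *
            Real.Gamma (((n : ℝ) + 1) / 2)) := by
  have hR := tendsto_saddleRatio (tendsto_saddleBoundaryIntegral hρ hf.continuousOn hC hb).2
  have hlim : Tendsto (fun n => saddleRatio ρ f n * Real.exp (ρ * (saddle (n + 1) - saddle n)) *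
      gammaRatio n) atTop (𝓝 (stripV ρ f)) := by
    have h1 := (Real.continuous_exp.tendsto _).comp (tendsto_saddle_succ_sub.const_mul ρ)
    have := (hR.mul h1).mul tendsto_gammaRatio
    simpa using this
  set A : ℕ → ℝ := fun n => 2 ^ n * Real.sqrt (2 * Real.pi * ((n : ℝ) + 1)) *
    Real.Gamma (((n : ℝ) + 1) / 2) with hA
  have hApos : ∀ n, 0 < A n := fun n => by
    have : 0 < Real.Gamma (((n : ℝ) + 1) / 2) := Real.Gamma_pos_of_pos (by positivity)
    simp only [hA]
    positivity
  have hs : ∀ n : ℕ, Real.sqrt (2 * ((n : ℝ) + 1)) = saddle (n + 1) := fun n => by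
    rw [saddle]; push_cast; rfl
  obtain ⟨K, hK, hKle⟩ := exists_tendsto_of_eventually_le (L := stripV ρ f)
    (x := fun n => ‖hermiteCoeff (fun x : ℝ => f (x : ℂ)) n‖ * A n *
      Real.exp (ρ * saddle (n + 1))) fun δ hδ => by
    filter_upwards [hlim.eventually_le_const (by linarith : stripV ρ f < stripV ρ f + δ),
      eventually_ge_atTop (m + 3)] with n h1 hn
    refine le_trans ?_ h1
    have h := norm_hermiteCoeff_mul_Gamma_le hρ hf hC hb hn
    have hG : 0 < Real.Gamma (((n : ℝ) + 1) / 2 + 1 / 2) := Real.Gamma_pos_of_pos (by positivity)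
    -- the prefactors with `√(2π(n+1)) Γ((n+1)/2)` and `2 √π Γ(n/2+1)` differ by `gammaRatio n`
    have e1 : Real.sqrt (2 * Real.pi * ((n : ℝ) + 1)) =
        2 * Real.sqrt Real.pi * Real.sqrt (((n : ℝ) + 1) / 2) := by
      rw [show 2 * Real.pi * ((n : ℝ) + 1) = 2 ^ 2 * (Real.pi * (((n : ℝ) + 1) / 2)) by ring,
        Real.sqrt_mul (by positivity), Real.sqrt_sq (by norm_num),
        Real.sqrt_mul Real.pi_pos.le, mul_assoc]
    have e2 : A n = 2 * Real.sqrt Real.pi *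
        (2 ^ n * Real.Gamma (((n : ℝ) + 1) / 2 + 1 / 2)) * gammaRatio n := by
      simp only [hA, e1, gammaRatio]
      field_simp
    have e3 : Real.exp (ρ * (saddle (n + 1) - saddle n)) =
        Real.exp (-(saddle n * ρ)) * Real.exp (ρ * saddle (n + 1)) := by
      rw [← Real.exp_add]; congr 1; ring
    have hg := gammaRatio_nonneg n
    calc _ = ‖hermiteCoeff (fun x : ℝ => f x) n‖ *
          (2 * Real.sqrt Real.pi * (2 ^ n * Real.Gamma (((n : ℝ) + 1) / 2 + 1 / 2))) *
          (gammaRatio n * Real.exp (ρ * saddle (n + 1))) := by rw [e2]; ring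
      _ ≤ Real.exp (-(saddle n * ρ)) * saddleRatio ρ f n *
          (gammaRatio n * Real.exp (ρ * saddle (n + 1))) := by gcongr
      _ = _ := by rw [e3]; ring
  refine ⟨K, hK, fun n => ?_⟩
  rw [hs, le_div_iff₀ (hApos n), neg_mul, Real.exp_neg, ← div_eq_mul_inv,
    le_div_iff₀ (Real.exp_pos _)]
  exact hKle n

/-- Comparison of the tail of `∑ exp (-2 ρ √(2k)) / √(2k)` with its integral, term by term. -/
theorem exp_neg_saddle_div_le {ρ : ℝ} (hρ : 0 < ρ) (n : ℕ) :
    Real.exp (-(2 * ρ * saddle (n + 1))) / saddle (n + 1) ≤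
      Real.exp (-(2 * ρ * saddle n)) / (2 * ρ) -
        Real.exp (-(2 * ρ * saddle (n + 1))) / (2 * ρ) := by
  have ha : 0 ≤ saddle n := Real.sqrt_nonneg _
  have hb : 0 < saddle (n + 1) := one_pos.trans_le (one_le_saddle (by omega))
  have h1 := saddle_sq n
  have h2 := saddle_sq (n + 1)
  push_cast at h2
  have h3 : saddle n ≤ saddle (n + 1) := Real.sqrt_le_sqrt (by push_cast; linarith)
  have h4 : (saddle (n + 1))⁻¹ ≤ saddle (n + 1) - saddle n := by
    rw [inv_le_iff_one_le_mul₀ hb]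
    nlinarith
  have h5 : Real.exp (-(2 * ρ * saddle n)) =
      Real.exp (-(2 * ρ * saddle (n + 1))) * Real.exp (2 * ρ * (saddle (n + 1) - saddle n)) := by
    rw [← Real.exp_add]; congr 1; ring
  have h6 := Real.add_one_le_exp (2 * ρ * (saddle (n + 1) - saddle n))
  rw [h5, ← sub_div, le_div_iff₀ (by positivity)]
  have hE := Real.exp_pos (-(2 * ρ * saddle (n + 1)))
  calc Real.exp (-(2 * ρ * saddle (n + 1))) / saddle (n + 1) * (2 * ρ)
      = Real.exp (-(2 * ρ * saddle (n + 1))) * (2 * ρ * (saddle (n + 1))⁻¹) := by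
        rw [div_eq_mul_inv]; ring
    _ ≤ Real.exp (-(2 * ρ * saddle (n + 1))) * (2 * ρ * (saddle (n + 1) - saddle n)) := by gcongr
    _ ≤ Real.exp (-(2 * ρ * saddle (n + 1))) *
        (Real.exp (2 * ρ * (saddle (n + 1) - saddle n)) - 1) := by gcongr; linarith
    _ = _ := by ring

/-- The terms of the Parseval sum; the first factor tends to `V²/(2π)`. -/
theorem norm_hermiteCoeff_sq_mul_hermiteGamma_le {ρ : ℝ} (hρ : 0 < ρ) {f : ℂ → ℂ}
    (hf : AnalyticOnNhd ℂ f (closedStrip ρ)) {C : ℝ} {m : ℕ} (hC : 0 ≤ C)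
    (hb : ∀ z ∈ closedStrip ρ, ‖f z‖ ≤ C * (1 + ‖z‖) ^ m) {n : ℕ} (hn : m + 3 ≤ n) :
    ‖hermiteCoeff (fun x : ℝ => f x) n‖ ^ 2 * hermiteGamma n ≤
      saddleRatio ρ f n ^ 2 * gammaRatio n / (2 * Real.pi) *
        (Real.exp (-(2 * ρ * saddle n)) / saddle n) := by
  have h := norm_hermiteCoeff_mul_Gamma_le hρ hf hC hb hn
  have hG : 0 < Real.Gamma (((n : ℝ) + 1) / 2 + 1 / 2) := Real.Gamma_pos_of_pos (by positivity)
  have hG' : 0 < Real.Gamma (((n : ℝ) + 1) / 2) := Real.Gamma_pos_of_pos (by positivity)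
  have hT : 0 < saddle n := one_pos.trans_le (one_le_saddle (by omega))
  have hg := gammaRatio_nonneg n
  have hq : 0 < Real.sqrt (((n : ℝ) + 1) / 2) := by positivity
  have hpi : Real.sqrt Real.pi ^ 2 = Real.pi := Real.sq_sqrt Real.pi_pos.le
  have hTq : saddle n ≤ 2 * Real.sqrt (((n : ℝ) + 1) / 2) := by
    rw [show (2 : ℝ) = Real.sqrt (2 ^ 2) by rw [Real.sqrt_sq (by norm_num)],
      ← Real.sqrt_mul (by norm_num), saddle]
    exact Real.sqrt_le_sqrt (by rw [Real.sqrt_sq (by norm_num)]; linarith)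
  have hsq := pow_le_pow_left₀ (by positivity) h 2
  set a := ‖hermiteCoeff (fun x : ℝ => f x) n‖
  set G := Real.Gamma (((n : ℝ) + 1) / 2 + 1 / 2)
  set q := Real.sqrt (((n : ℝ) + 1) / 2)
  have e1 : hermiteGamma n = (2 * Real.sqrt Real.pi * (2 ^ n * G)) ^ 2 *
      (gammaRatio n / (4 * Real.pi * q)) := by
    have hgr : gammaRatio n = q * Real.Gamma (((n : ℝ) + 1) / 2) / G := rfl
    have hγ : hermiteGamma n = 2 ^ n * (2 ^ n * (Real.Gamma (((n : ℝ) + 1) / 2) * G)) :=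
      hermiteGamma_eq n
    rw [hγ, hgr, mul_pow, mul_pow 2, hpi]
    field_simp
    ring
  have e2 : Real.exp (-(2 * ρ * saddle n)) = Real.exp (-(saddle n * ρ)) ^ 2 := by
    rw [← Real.exp_nat_mul]; congr 1; push_cast; ring
  calc a ^ 2 * hermiteGamma n = (a * (2 * Real.sqrt Real.pi * (2 ^ n * G))) ^ 2 *
        (gammaRatio n / (4 * Real.pi * q)) := by rw [e1]; ring
    _ ≤ (Real.exp (-(saddle n * ρ)) * saddleRatio ρ f n) ^ 2 *
        (gammaRatio n / (4 * Real.pi * q)) := by gcongr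
    _ = saddleRatio ρ f n ^ 2 * gammaRatio n / (2 * Real.pi) *
        (Real.exp (-(2 * ρ * saddle n)) / (2 * q)) := by rw [e2]; field_simp; ring
    _ ≤ _ := by gcongr

theorem exists_normL2Weight_bound {ρ : ℝ} (hρ : 0 < ρ) {f : ℂ → ℂ}
    (hf : AnalyticOnNhd ℂ f (closedStrip ρ)) {C : ℝ} {m : ℕ} (hC : 0 ≤ C)
    (hb : ∀ z ∈ closedStrip ρ, ‖f z‖ ≤ C * (1 + ‖z‖) ^ m)
    (hmem : MemL2Weight fun x : ℝ => f (x : ℂ)) :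
    ∃ K : ℕ → ℝ, Tendsto K atTop (𝓝 (stripV ρ f / Real.sqrt (4 * Real.pi * ρ))) ∧
      ∀ n : ℕ,
        normL2Weight (fun x : ℝ => f (x : ℂ) - hermiteProj n (fun t : ℝ => f (t : ℂ)) x) ≤
          K n * Real.exp (-ρ * Real.sqrt (2 * (n : ℝ))) := by
  set V := stripV ρ f with hV
  have hR := tendsto_saddleRatio (tendsto_saddleBoundaryIntegral hρ hf.continuousOn hC hb).2
  have hV0 : 0 ≤ V := ge_of_tendsto' hR fun n => saddleRatio_nonneg ρ f n
  set c : ℕ → ℝ := fun n => saddleRatio ρ f n ^ 2 * gammaRatio n / (2 * Real.pi) with hc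
  have hclim : Tendsto c atTop (𝓝 (V ^ 2 / (2 * Real.pi))) := by
    have := ((hR.pow 2).mul tendsto_gammaRatio).div_const (2 * Real.pi)
    simpa using this
  set E : ℕ → ℝ := fun n =>
    normL2Weight (fun x : ℝ => f (x : ℂ) - hermiteProj n (fun t : ℝ => f (t : ℂ)) x) with hE
  have hE0 : ∀ n, 0 ≤ E n := fun n => Real.sqrt_nonneg _
  set L := V / Real.sqrt (4 * Real.pi * ρ) with hL
  have hL0 : 0 ≤ L := by positivity
  have hL2 : L ^ 2 = V ^ 2 / (4 * Real.pi * ρ) := by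
    rw [hL, div_pow, Real.sq_sqrt (by positivity)]
  obtain ⟨K, hK, hKle⟩ := exists_tendsto_of_eventually_le (L := L)
    (x := fun n => E n * Real.exp (ρ * saddle n)) fun δ hδ => by
    -- the slack `2 ρ δ²` becomes `δ²` after the summation, and `L² + δ² ≤ (L + δ)²`
    have hev := hclim.eventually_le_const
      (by linarith [show 0 < 2 * ρ * δ ^ 2 by positivity] :
        V ^ 2 / (2 * Real.pi) < V ^ 2 / (2 * Real.pi) + 2 * ρ * δ ^ 2)
    obtain ⟨N, hN⟩ := eventually_atTop.1 hev
    filter_upwards [eventually_ge_atTop (N + (m + 3))] with n hn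
    set M := V ^ 2 / (2 * Real.pi) + 2 * ρ * δ ^ 2 with hM
    have hM0 : 0 ≤ M := by positivity
    have hsum := hasSum_normL2Weight_sub_hermiteProj_sq hmem n
    have hle : E n ^ 2 ≤ M * (Real.exp (-(2 * ρ * saddle n)) / (2 * ρ)) := by
      refine le_of_tendsto' hsum.tendsto_sum_nat fun N' => ?_
      have hterm : ∀ k, ‖hermiteCoeff (fun x : ℝ => f (x : ℂ)) (k + (n + 1))‖ ^ 2 *
          hermiteGamma (k + (n + 1)) ≤
          M * (Real.exp (-(2 * ρ * saddle (k + n))) / (2 * ρ) -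
            Real.exp (-(2 * ρ * saddle (k + 1 + n))) / (2 * ρ)) := fun k => by
        have h1 := norm_hermiteCoeff_sq_mul_hermiteGamma_le hρ hf hC hb
          (n := k + (n + 1)) (by omega)
        have h2 := hN (k + (n + 1)) (by omega)
        have h3 := exp_neg_saddle_div_le hρ (k + n)
        have hT : 0 < saddle (k + (n + 1)) := one_pos.trans_le (one_le_saddle (by omega))
        rw [show k + n + 1 = k + (n + 1) by omega] at h3
        rw [show k + 1 + n = k + (n + 1) by omega]
        calc _ ≤ _ := h1
          _ ≤ M * (Real.exp (-(2 * ρ * saddle (k + (n + 1)))) / saddle (k + (n + 1))) := by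
            gcongr
          _ ≤ _ := by gcongr
      refine (Finset.sum_le_sum fun k _ => hterm k).trans ?_
      rw [← Finset.mul_sum, Finset.sum_range_sub'
        (fun k => Real.exp (-(2 * ρ * saddle (k + n))) / (2 * ρ)), zero_add]
      gcongr
      exact sub_le_self _ (by positivity)
    refine (pow_le_pow_iff_left₀ (mul_nonneg (hE0 n) (Real.exp_pos _).le) (by positivity)
      two_ne_zero).1 ?_
    have e1 : Real.exp (-(2 * ρ * saddle n)) * Real.exp (ρ * saddle n) ^ 2 = 1 := by
      rw [← Real.exp_nat_mul, ← Real.exp_add, Real.exp_eq_one_iff]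
      push_cast
      ring
    calc (E n * Real.exp (ρ * saddle n)) ^ 2 =
          E n ^ 2 * Real.exp (ρ * saddle n) ^ 2 := mul_pow _ _ _
      _ ≤ M * (Real.exp (-(2 * ρ * saddle n)) / (2 * ρ)) * Real.exp (ρ * saddle n) ^ 2 := by gcongr
      _ = M / (2 * ρ) * (Real.exp (-(2 * ρ * saddle n)) * Real.exp (ρ * saddle n) ^ 2) := by ring
      _ = L ^ 2 + δ ^ 2 := by
        rw [e1, hL2, hM]
        field_simp
        ring
      _ ≤ (L + δ) ^ 2 := by nlinarith
  refine ⟨K, hK, fun n => ?_⟩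
  have h := hKle n
  rw [neg_mul, Real.exp_neg, ← div_eq_mul_inv, le_div_iff₀ (Real.exp_pos _)]
  exact h

theorem mainTheorem2 (ρ σ : ℝ) (hρ : 0 < ρ) (f : ℂ → ℂ)
    (hf : AnalyticOnNhd ℂ f (closedStrip ρ))
    (hgrowth : f =O[Bornology.cobounded ℂ ⊓ 𝓟 (closedStrip ρ)] fun z : ℂ => ‖z‖ ^ σ) :
    StripBoundaryIntegrable ρ (gaussAbs f) ∧
    MemL2Weight (fun x : ℝ => f (x : ℂ)) ∧
    (∃ K : ℕ → ℝ, Tendsto K atTop (𝓝 (stripV ρ f)) ∧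
      ∀ n : ℕ, max ⌊σ⌋ 0 ≤ (n : ℤ) →
        ‖hermiteCoeff (fun x : ℝ => f (x : ℂ)) n‖ ≤
          K n * Real.exp (-ρ * Real.sqrt (2 * ((n : ℝ) + 1))) /
            (2 ^ n * Real.sqrt (2 * Real.pi * ((n : ℝ) + 1)) *
              Real.Gamma (((n : ℝ) + 1) / 2))) ∧
    (∃ K : ℕ → ℝ, Tendsto K atTop (𝓝 (stripV ρ f / Real.sqrt (4 * Real.pi * ρ))) ∧
      ∀ n : ℕ,
        normL2Weight (fun x : ℝ => f (x : ℂ) - hermiteProj n (fun t : ℝ => f (t : ℂ)) x) ≤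
          K n * Real.exp (-ρ * Real.sqrt (2 * (n : ℝ)))) := by
  obtain ⟨C, m, hC, hb⟩ := exists_norm_le_of_isBigO hf.continuousOn hgrowth
  have hcont : Continuous fun x : ℝ => f (x : ℂ) :=
    hf.continuousOn.comp_continuous Complex.continuous_ofReal fun x => by
      simp [closedStrip, hρ.le]
  have hmem : MemL2Weight fun x : ℝ => f (x : ℂ) :=
    memL2Weight_of_norm_le hcont (C := C) (m := m) fun x => by
      simpa using hb x (by simp [closedStrip, hρ.le])
  obtain ⟨K, hK, hKle⟩ := exists_hermiteCoeff_bound hρ hf hC hb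
  exact ⟨(tendsto_saddleBoundaryIntegral hρ hf.continuousOn hC hb).1, hmem,
    ⟨K, hK, fun n _ => hKle n⟩, exists_normL2Weight_bound hρ hf hC hb hmem⟩
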